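/- Let $n\ge 1$, $m\ge 0$. For $i=1,\dots,n$ let $f_i:\mathbb{R}^m\to\mathbb{R}$ be differentiable and convex, such that $X_i=\{x:\nabla f_i(x)=0\}$ is nonempty and bounded, and let $H_i\subseteq\mathbb{R}^m$ be a closed convex set, such that $H=\bigcap_{i=1}^n H_i\neq\emptyset$. Neither the sets $H_i$ nor the gradients $\nabla f_i$ are assumed to be bounded. Let $$\mathcal{X}=\Big\{s\in H:\ \sum_{i=1}^n f_i(s)\le\sum_{i=1}^n f_i(y)\ \text{ for all } y\in H\Big\}.$$ Let $\eta>0$ and, for $t\ge 0$, let $\mathcal{G}(t)$ be a weighted directed graph on $\{1,\dots,n\}$ without self-loops, with weights $a_{ij}(t)\ge\eta$ if $(j,i)$ is an edge of $\mathcal{G}(t)$ and $a_{ij}(t)=0$ otherwise; let $N_i(t)=\{j:(j,i)\text{ is an edge of }\mathcal{G}(t)\}$. Assume: * $\mathcal{G}(t)$ is balanced for all $t\ge0$: $\sum_j a_{ij}(t)=\sum_j a_{ji}(t)$ for all $i$; * there are a constant $d_w>0$ and switching times $0=\sigma_0<\sigma_1<\sigma_2<\cdots$ with $\sigma_{k+1}-\sigma_k\ge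 d_w$ such that the weighted graph $\mathcal{G}(t)$ is constant on each $[\sigma_k,\sigma_{k+1})$; * for some constant $M>d_w$ there is an infinite sequence $0=t_0<t_1<t_2<\cdots$ of switching times with $t_{j+1}-t_j\le M$ such that the union of the graphs $\mathcal{G}(t)$, $t\in[t_j,t_{j+1})$, is strongly connected for every $j\ge 0$. Let $x_i:[0,\infty)\to\mathbb{R}^m$ (continuous, with arbitrary initial values $x_i(0)$) and $q_i:[0,\infty)\to\mathbb{R}$, $i=1,\dots,n$, satisfy $$\dot q_i(t)=\arctan\big(e^{\|x_i(t)\|}\big),\qquad q_i(0)>0,$$ $$\dot x_i(t)=\sum_{j\in N_i(t)}a_{ij}(t)\big(x_j(t)-x_i(t)\big)-\big[x_i(t)-P_{H_i}(x_i(t))\big]-\frac{\nabla f_i(x_i(t))}{\sqrt{q_i(t)}},$$ the second equation at all $t>0$ that are not switching times, where $P_{H_i}$ is the Euclidean projection onto $H_i$. Then, with $x^*(t)=\frac1n\sum_{i=1}^n x_i(t)$: * $\mathcal{X}$ is nonempty and bounded; * the agents reach consensus: $\lim_{t\to\infty}[x_i(t)-x^*(t)]=0$ for all $i$; * the agents converge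 to the optimal set and minimize the team objective asymptotically: $\lim_{t\to\infty}\mathrm{dist}(x_i(t),\mathcal{X})=0$ for all $i$, and $\lim_{t\to\infty}\sum_{i=1}^n f_i(x_i(t))=\min_{s\in H}\sum_{i=1}^n f_i(s)$. -/

import Mathlib

open Set Filter Topology
open scoped BigOperators

namespace DistOpt

/-- The Euclidean space `ℝ^m`. -/
abbrev E (m : ℕ) : Type := EuclideanSpace ℝ (Fin m)

/-! ### Projection onto a closed convex set -/

section Projection

variable {m : ℕ}

open Classical in
/-- The projection `P_C(s) = argmin_{y ∈ C} ‖s - y‖` (the value `0` is used only if there is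
no nearest point, which does not happen for nonempty closed `C`, see `metricProj_spec`). -/
noncomputable def metricProj (C : Set (E m)) (s : E m) : E m :=
  if h : ∃ y ∈ C, ∀ z ∈ C, ‖s - y‖ ≤ ‖s - z‖ then h.choose else 0

theorem metricProj_spec {C : Set (E m)} (hne : C.Nonempty) (hC : IsClosed C) (s : E m) :
    metricProj C s ∈ C ∧ ∀ z ∈ C, ‖s - metricProj C s‖ ≤ ‖s - z‖ := by
  have h : ∃ y ∈ C, ∀ z ∈ C, ‖s - y‖ ≤ ‖s - z‖ := by
    obtain ⟨y, hy, hd⟩ := hC.exists_infDist_eq_dist hne s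
    refine ⟨y, hy, fun z hz => ?_⟩
    rw [← dist_eq_norm, ← dist_eq_norm, ← hd]
    exact Metric.infDist_le_dist_of_mem hz
  rw [metricProj, dif_pos h]
  exact h.choose_spec

/-- The nearest point of a closed convex set is unique, so `metricProj` is the projection. -/
theorem metricProj_eq {C : Set (E m)} (hC : IsClosed C) (hconv : Convex ℝ C) {s y : E m}
    (hy : y ∈ C) (hmin : ∀ z ∈ C, ‖s - y‖ ≤ ‖s - z‖) : metricProj C s = y := by
  obtain ⟨hp, hpmin⟩ := metricProj_spec ⟨y, hy⟩ hC s
  set p := metricProj C s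
  have hmid : (1 / 2 : ℝ) • p + (1 / 2 : ℝ) • y ∈ C :=
    hconv hp hy (by norm_num) (by norm_num) (by norm_num)
  have h1 := hmin _ hmid
  have h2 : ‖s - p‖ = ‖s - y‖ := le_antisymm (hpmin y hy) (hmin p hp)
  have hpar := parallelogram_law_with_norm ℝ (s - p) (s - y)
  have h3 : (s - p) + (s - y) = (2 : ℝ) • (s - ((1 / 2 : ℝ) • p + (1 / 2 : ℝ) • y)) := by
    module
  have h4 : (s - p) - (s - y) = y - p := by abel
  rw [h3, h4, norm_smul, Real.norm_ofNat, h2] at hpar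
  have h5 : ‖y - p‖ = 0 := by
    nlinarith [norm_nonneg (y - p), norm_nonneg (s - y),
      norm_nonneg (s - ((1 / 2 : ℝ) • p + (1 / 2 : ℝ) • y))]
  exact (sub_eq_zero.mp (norm_eq_zero.mp h5)).symm

end Projection

/-! ### Communication graphs -/

/-- A weighted directed graph on the agents `Fin n`, without self-loops. `Adj j i` means that
`(j, i)` is an edge, i.e. agent `i` obtains information from agent `j`. The weight `a i j` is at
least `η` if `(j, i)` is an edge, and zero otherwise. -/
structure CommGraph (n : ℕ) (η : ℝ) extends Digraph (Fin n) where
  a : Matrix (Fin n) (Fin n) ℝ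
  no_loop : ∀ i, ¬ Adj i i
  le_a : ∀ i j, Adj j i → η ≤ a i j
  a_eq_zero : ∀ i j, ¬ Adj j i → a i j = 0

/-- A digraph is strongly connected if there is a path from every vertex to every other one. -/
def StronglyConnected {n : ℕ} (D : Digraph (Fin n)) : Prop :=
  ∀ i j, i ≠ j → Relation.TransGen D.Adj i j

section Graph

variable {n : ℕ} {η : ℝ}

/-- The graph is balanced: `∑ j, a i j = ∑ j, a j i` for all `i`. -/
def CommGraph.Balanced (G : CommGraph n η) : Prop :=
  ∀ i, ∑ j, G.a i j = ∑ j, G.a j i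

open Classical in
/-- The neighbours `N_i = {j | (j, i) is an edge}` of agent `i`. -/
noncomputable def CommGraph.neighbors (G : CommGraph n η) (i : Fin n) : Finset (Fin n) :=
  Finset.univ.filter fun j => G.Adj j i

/-- The union of the graphs `G t` over `t ∈ [s, s')`. -/
def unionGraph (G : ℝ → CommGraph n η) (s s' : ℝ) : Digraph (Fin n) where
  Adj u v := ∃ t ∈ Ico s s', (G t).Adj u v

/-- `σ 0 = 0 < σ 1 < σ 2 < ⋯` are switching times of the time-varying graph `G`: the weighted graph
is constant between two contiguous ones, and their distance is at least `dw`. -/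
structure IsSwitchingSequence (G : ℝ → CommGraph n η) (dw : ℝ) (σ : ℕ → ℝ) : Prop where
  zero : σ 0 = 0
  dwell : ∀ k, dw ≤ σ (k + 1) - σ k
  const : ∀ k, ∀ t ∈ Ico (σ k) (σ (k + 1)), G t = G (σ k)

/-- There are infinitely many switching times `0 = t_0 < t_1 < ⋯` with gaps at most `M` such that
the union of the graphs over each `[t_j, t_{j+1})` is strongly connected. -/
def JointlyStronglyConnected (G : ℝ → CommGraph n η) (σ : ℕ → ℝ) (M : ℝ) : Prop :=
  ∃ τ : ℕ → ℝ, (∀ j, τ j ∈ range σ) ∧ τ 0 = 0 ∧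
    ∀ j, 0 < τ (j + 1) - τ j ∧ τ (j + 1) - τ j ≤ M ∧
      StronglyConnected (unionGraph G (τ j) (τ (j + 1)))

end Graph

/-! ### The optimization problem and the algorithm -/

section Problem

variable {n m : ℕ} {η : ℝ}

/-- The optimal set of: minimize `∑ i, f i s` subject to `s ∈ ⋂ i, H i`. -/
def optimalSet (f : Fin n → E m → ℝ) (H : Fin n → Set (E m)) : Set (E m) :=
  {s | s ∈ ⋂ i, H i ∧ ∀ y ∈ ⋂ i, H i, ∑ i, f i s ≤ ∑ i, f i y}

/-- The average `x^* = (1/n) ∑ i, x i`. -/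
noncomputable def average (x : Fin n → E m) : E m := (1 / (n : ℝ)) • ∑ i, x i

/-- The control input of agent `i`, for graph `G`, states `x` and gain variables `q`. -/
noncomputable def control (f : Fin n → E m → ℝ) (H : Fin n → Set (E m)) (G : CommGraph n η)
    (x : Fin n → E m) (q : Fin n → ℝ) (i : Fin n) : E m :=
  ∑ j ∈ G.neighbors i, G.a i j • (x j - x i) - (x i - metricProj (H i) (x i))
    - (1 / Real.sqrt (q i)) • gradient (f i) (x i)

/-- `(x, q)` is a trajectory on `[0, ∞)` of the closed-loop system
`x_i' = u_i`, `q_i' = arctan (exp ‖x_i‖)`, `q_i(0) > 0`. The states are continuous, and their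
differential equation holds at every positive time that is not one of the switching times `σ k`,
where the right-hand side may jump. -/
structure IsTrajectory (f : Fin n → E m → ℝ) (H : Fin n → Set (E m)) (G : ℝ → CommGraph n η)
    (σ : ℕ → ℝ) (x : Fin n → ℝ → E m) (q : Fin n → ℝ → ℝ) : Prop where
  x_cont : ∀ i, ContinuousOn (x i) (Ici 0)
  x_deriv : ∀ i, ∀ t : ℝ, 0 < t → t ∉ range σ →
    HasDerivAt (x i) (control f H (G t) (fun j => x j t) (fun j => q j t) i) t
  q_init : ∀ i, 0 < q i 0
  q_deriv : ∀ i, ∀ t : ℝ, 0 ≤ t →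
    HasDerivWithinAt (q i) (Real.arctan (Real.exp ‖x i t‖)) (Ici 0) t

end Problem

end DistOpt

/-! For a fixed point `z` of the constraint set, the derivative of `∑ ‖x i - z‖ ^ 2` is at most
minus the dissipation (weighted disagreement plus squared distances to the sets `H i`) plus `2 ∑ (1
/ √q i) (f i z - f i (x i))`. This is `two_mul_sum_inner_control_le`; it rests on balance, the
variational inequality of the projection, and the gradient inequality. As `arctan (exp ‖·‖)` lies in
`[π/4, π/2)`, the step sizes are comparable to `1 / √(1 + t)`, which tends to zero but is not
integrable. Linear growth of the `f i` makes the derivative negative far away, so the states stay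
bounded and every later estimate takes place on a compact set.

Consensus (`tendsto_sqDist_constraint`) uses the Lyapunov function `sqDist (⋂ i, H i)`. Over two
successive connectivity windows it either drops by a fixed amount, or little is dissipated. In the
latter case the agents must be close together at some time of the first window: otherwise a gap in
some direction would persist through the second window, and an edge across it, active for at least
the dwell time, would dissipate too much. The weights have no upper bound, so the motion into the
gap is bounded by the dissipation itself (`gap_persists`). Small dissipation also puts each agent
near its own `H i`, and compactness turns this into nearness to the intersection.

Consensus makes the rates of the gains asymptotically equal, so `q i - q j = o(t)` and the step
sizes differ by `o(1 / √t)`. Up to this error the weighted sum above is a common step size times the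
gap of the team objective. Away from the optimal set that gap is bounded away from zero, so `sqDist
(optimalSet f H)` decreases at a rate `c / √(1 + t)` (`exists_descent_rate`), whose integral
diverges. It therefore falls below any level and cannot rise above it again. All limits in the
theorem follow from its convergence to zero. -/

namespace DistOpt

/-! ### Real-variable and compactness tools -/

/-- A finite family of functions that starts below a barrier and can only touch it with a smaller
right derivative stays below the barrier. -/
theorem forall_le_barrier {ι : Type*} [Finite ι] {ψ ψ' : ι → ℝ → ℝ} {B B' : ℝ → ℝ} {a b : ℝ}
    (hψ : ∀ k, ContinuousOn (ψ k) (Icc a b)) (hB : ContinuousOn B (Icc a b))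
    (hψ' : ∀ k, ∀ t ∈ Ico a b, HasDerivWithinAt (ψ k) (ψ' k t) (Ici t) t)
    (hB' : ∀ t ∈ Ico a b, HasDerivWithinAt B (B' t) (Ici t) t)
    (h0 : ∀ k, ψ k a ≤ B a)
    (hlt : ∀ t ∈ Ico a b, (∀ l, ψ l t ≤ B t) → ∀ k, ψ k t = B t → ψ' k t < B' t) :
    ∀ t ∈ Icc a b, ∀ k, ψ k t ≤ B t := by
  have hclosed : IsClosed ({t | ∀ k, ψ k t ≤ B t} ∩ Icc a b) := by
    have : {t | ∀ k, ψ k t ≤ B t} ∩ Icc a b = Icc a b ∩ ⋂ k, {t ∈ Icc a b | ψ k t ≤ B t} := by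
      ext t
      simp only [mem_inter_iff, mem_ofPred_eq, mem_iInter]
      exact ⟨fun h => ⟨h.2, fun k => ⟨h.2, h.1 k⟩⟩, fun h => ⟨fun k => (h.2 k).2, h.1⟩⟩
    rw [this]
    exact isClosed_Icc.inter (isClosed_iInter fun k => isClosed_Icc.isClosed_le (hψ k) hB)
  refine hclosed.Icc_subset_of_forall_exists_gt h0 ?_
  rintro t ⟨ht, htI⟩ y hy
  have hev : ∀ k, ∀ᶠ s in 𝓝[>] t, ψ k s ≤ B s := by
    intro k
    have h1 : HasDerivWithinAt (fun s => ψ k s - B s) (ψ' k t - B' t) (Ici t) t :=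
      (hψ' k t htI).sub (hB' t htI)
    -- Strictly below the barrier, right continuity suffices; at a contact point the difference has
    -- negative right derivative.
    rcases (ht k).lt_or_eq with hlt' | heq
    · have h2 : ∀ᶠ s in 𝓝[>] t, ψ k s - B s < 0 :=
        (h1.continuousWithinAt.mono Ioi_subset_Ici_self).eventually_lt_const (by linarith)
      exact h2.mono fun s hs => by linarith
    · have h2 := (hasDerivWithinAt_iff_tendsto_slope' self_notMem_Ioi).1 h1.Ioi_of_Ici
      have h3 := h2.eventually_lt_const (sub_neg.2 (hlt t htI ht k heq))
      filter_upwards [h3, self_mem_nhdsWithin] with s hs hts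
      rw [slope_def_field, heq, sub_self, sub_zero, div_lt_iff₀ (sub_pos.2 hts)] at hs
      linarith
  have hall : ∀ᶠ s in 𝓝[>] t, ∀ k, ψ k s ≤ B s := eventually_all.2 hev
  obtain ⟨s, hs, hsI⟩ := (hall.and (Ioc_mem_nhdsGT hy)).exists
  exact ⟨s, hs, hsI⟩

/-- On a compact set, a continuous function is small where a nonnegative continuous function,
whose zeros it shares, is small. -/
theorem exists_pos_of_compact {α : Type*} [TopologicalSpace α] {K : Set α} (hK : IsCompact K)
    {h u : α → ℝ} (hh : Continuous h) (hu : Continuous u) (hpos : ∀ x, 0 ≤ h x)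
    (hzero : ∀ x, h x = 0 → u x ≤ 0) {δ : ℝ} (hδ : 0 < δ) :
    ∃ ε > 0, ∀ x ∈ K, h x < ε → u x < δ := by
  have hK' : IsCompact (K ∩ {x | δ ≤ u x}) := hK.inter_right (isClosed_le continuous_const hu)
  rcases (K ∩ {x | δ ≤ u x}).eq_empty_or_nonempty with he | hne
  · refine ⟨1, one_pos, fun x hx _ => ?_⟩
    by_contra hc
    exact (he ▸ (⟨hx, not_lt.1 hc⟩ : x ∈ K ∩ {x | δ ≤ u x}) : x ∈ (∅ : Set α)).elim
  · obtain ⟨x₀, hx₀, hmin⟩ := hK'.exists_isMinOn hne hh.continuousOn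
    have hx₀pos : 0 < h x₀ := by
      refine (hpos x₀).lt_of_ne fun h0 => ?_
      have h1 := hzero x₀ h0.symm
      have h2 : δ ≤ u x₀ := hx₀.2
      linarith
    refine ⟨h x₀, hx₀pos, fun x hx hlt => ?_⟩
    by_contra hc
    exact absurd (hmin ⟨hx, not_lt.1 hc⟩) (not_le.2 hlt)

/-- Finitely many reals without gaps of length `γ` above any of them are close to each other. -/
theorem sub_le_of_no_gap {ι : Type*} [Fintype ι] {y : ι → ℝ} {γ : ℝ} (hγ : 0 ≤ γ)
    (h : ∀ k l, y k < y l → ∃ l', y k < y l' ∧ y l' ≤ y k + γ) (k l : ι) :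
    y l - y k ≤ γ * Fintype.card ι := by
  classical
  -- Climb from `y k` in steps of at most `γ`; each step reduces the number of values still above.
  have key : ∀ N : ℕ, ∀ k, (Finset.univ.filter fun j => y k < y j).card ≤ N →
      y l - y k ≤ γ * N := by
    intro N
    induction N with
    | zero =>
      intro k hk
      by_contra hc
      have : l ∈ Finset.univ.filter fun j => y k < y j := by
        simp only [Finset.mem_filter, Finset.mem_univ, true_and]
        simp at hc
        linarith
      have h2 := Finset.card_pos.2 ⟨l, this⟩
      omega
    | succ N ih =>
      intro k hk
      rcases le_or_gt (y l) (y k) with hle | hgt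
      · have : 0 ≤ γ * ((N + 1 : ℕ) : ℝ) := by positivity
        linarith
      · obtain ⟨l', hl', hl''⟩ := h k l hgt
        have hss : (Finset.univ.filter fun j => y l' < y j) ⊂
            Finset.univ.filter fun j => y k < y j := by
          rw [Finset.ssubset_iff_of_subset]
          · exact ⟨l', by simp [hl'], by simp⟩
          · intro j hj
            simp only [Finset.mem_filter, Finset.mem_univ, true_and] at hj ⊢
            linarith
        have h1 := ih l' (by have := Finset.card_lt_card hss; omega)
        push_cast
        linarith
  refine (key _ k le_rfl).trans ?_
  gcongr
  exact Finset.card_le_univ _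

/-- A strongly connected digraph has an edge that leaves any nonempty proper set of vertices. -/
theorem StronglyConnected.exists_adj_of_mem {n : ℕ} {D : Digraph (Fin n)}
    (hD : StronglyConnected D) {S : Set (Fin n)} {u w : Fin n} (hu : u ∈ S) (hw : w ∉ S) :
    ∃ u' ∈ S, ∃ w' ∉ S, D.Adj u' w' := by
  by_contra hc
  push Not at hc
  have key : ∀ v, Relation.TransGen D.Adj u v → v ∈ S := by
    intro v hv
    induction hv with
    | single h =>
      by_contra hb
      exact hc u hu _ hb h
    | tail _ h ih =>
      by_contra hb
      exact hc _ ih _ hb h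
  exact hw (key w (hD u w fun h => hw (h ▸ hu)))

/-- A sequence that, as long as it exceeds `δ`, drops by a fixed amount is eventually at most
`δ`. -/
theorem eventually_le_of_drop {u : ℕ → ℝ} {δ ε : ℝ} (hε : 0 < ε) (hu : ∀ k, 0 ≤ u k)
    (h : ∀ᶠ k in atTop, u (k + 1) ≤ u k - ε ∨ u (k + 1) ≤ δ) : ∀ᶠ k in atTop, u k ≤ δ := by
  obtain ⟨K, hK⟩ := eventually_atTop.1 h
  have hex : ∃ k ≥ K, u k ≤ δ := by
    by_contra hc
    push Not at hc
    have hdrop : ∀ j : ℕ, u (K + j) ≤ u K - j * ε := by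
      intro j
      induction j with
      | zero => simp
      | succ j ih =>
        rcases hK (K + j) (by omega) with h1 | h1
        · rw [← add_assoc]
          push_cast
          linarith
        · exact absurd h1 (not_le.2 (hc (K + j + 1) (by omega)))
    obtain ⟨j, hj⟩ := exists_nat_gt (u K / ε)
    rw [div_lt_iff₀ hε] at hj
    linarith [hdrop j, hu (K + j)]
  obtain ⟨k, hk, hkδ⟩ := hex
  refine eventually_atTop.2 ⟨k, fun l hl => ?_⟩
  induction l, hl using Nat.le_induction with
  | base => exact hkδ
  | succ l hl ih =>
    rcases hK l (by omega) with h1 | h1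
    · linarith
    · exact h1

/-- The inverse square root is Lipschitz away from zero. -/
theorem abs_one_div_sqrt_sub_le {a b c : ℝ} (hc : 0 < c) (ha : c ≤ a) (hb : c ≤ b) :
    |1 / Real.sqrt a - 1 / Real.sqrt b| ≤ |a - b| / (c * Real.sqrt c) := by
  have hw : 0 < Real.sqrt c := Real.sqrt_pos.2 hc
  have hu : Real.sqrt c ≤ Real.sqrt a := Real.sqrt_le_sqrt ha
  have hv : Real.sqrt c ≤ Real.sqrt b := Real.sqrt_le_sqrt hb
  have hu0 : 0 < Real.sqrt a := hw.trans_le hu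
  have hv0 : 0 < Real.sqrt b := hw.trans_le hv
  have h1 : 1 / Real.sqrt a - 1 / Real.sqrt b =
      (b - a) / (Real.sqrt a * Real.sqrt b * (Real.sqrt a + Real.sqrt b)) := by
    have h2 := Real.sq_sqrt (hc.le.trans ha)
    have h3 := Real.sq_sqrt (hc.le.trans hb)
    field_simp
    linarith
  rw [h1, abs_div, abs_sub_comm b a, abs_of_pos (by positivity : 0 < Real.sqrt a * Real.sqrt b *
    (Real.sqrt a + Real.sqrt b))]
  have h4 : c = Real.sqrt c * Real.sqrt c := (Real.mul_self_sqrt hc.le).symm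
  gcongr
  · calc c = Real.sqrt c * Real.sqrt c := h4
      _ ≤ Real.sqrt a * Real.sqrt b := by gcongr
  · linarith

/-! ### Differentiable convex functions -/

section ConvexFunctions

variable {F : Type*} [NormedAddCommGroup F] [InnerProductSpace ℝ F] [CompleteSpace F] {f : F → ℝ}

theorem inner_gradient_le (hf : ConvexOn ℝ univ f) (hd : Differentiable ℝ f) (x y : F) :
    inner ℝ (gradient f x) (y - x) ≤ f y - f x := by
  have h1 : HasDerivAt (fun t : ℝ => f (x + t • (y - x))) (inner ℝ (gradient f x) (y - x)) 0 := by
    have hg : HasFDerivAt f (InnerProductSpace.toDual ℝ F (gradient f x))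
        (x + (0 : ℝ) • (y - x)) := by
      rw [zero_smul, add_zero]
      exact (hd x).hasGradientAt.hasFDerivAt
    have hl : HasDerivAt (fun t : ℝ => x + t • (y - x)) (y - x) 0 := by
      simpa using ((hasDerivAt_id (0 : ℝ)).smul_const (y - x)).const_add x
    exact hg.comp_hasDerivAt (0 : ℝ) hl
  have h2 := (hasDerivWithinAt_iff_tendsto_slope' self_notMem_Ioi).1
    (h1.hasDerivWithinAt (s := Ioi 0))
  refine le_of_tendsto h2 ?_
  filter_upwards [Ioc_mem_nhdsGT (zero_lt_one' ℝ)] with t ht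
  rw [slope_def_field, sub_zero, div_le_iff₀ ht.1]
  have h3 := hf.2 (mem_univ x) (mem_univ y) (sub_nonneg.2 ht.2) ht.1.le (by ring)
  have h4 : (1 - t) • x + t • y = x + t • (y - x) := by module
  rw [h4, smul_eq_mul, smul_eq_mul] at h3
  simp only [zero_smul, add_zero]
  linarith

/-- A unit step `e` along the gradient raises `f` by at least the norm of the gradient, while `f` is
bounded on the ball enlarged by one. -/
theorem exists_norm_gradient_le [ProperSpace F] (hf : ConvexOn ℝ univ f) (hd : Differentiable ℝ f)
    (R : ℝ) : ∃ L > 0, ∀ x, ‖x‖ ≤ R → ‖gradient f x‖ ≤ L := by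
  obtain ⟨C, hC⟩ := (isCompact_closedBall (0 : F) (R + 1)).exists_bound_of_continuousOn
    hd.continuous.continuousOn
  refine ⟨|2 * C| + 1, by positivity, fun x hx => ?_⟩
  rcases eq_or_ne (gradient f x) 0 with h0 | h0
  · rw [h0, norm_zero]; positivity
  · have hn : 0 < ‖gradient f x‖ := norm_pos_iff.2 h0
    set e : F := ‖gradient f x‖⁻¹ • gradient f x
    have he : ‖e‖ = 1 := by
      simp only [e, norm_smul, norm_inv, norm_norm]
      field_simp
    have h1 := inner_gradient_le hf hd x (x + e)
    have h2 : inner ℝ (gradient f x) (x + e - x) = ‖gradient f x‖ := by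
      rw [add_sub_cancel_left, inner_smul_right, real_inner_self_eq_norm_sq]
      field_simp
    have h3 := hC x (by simp; linarith)
    have h4 := hC (x + e) (by simp; linarith [norm_add_le x e])
    rw [Real.norm_eq_abs, abs_le] at h3 h4
    have := le_abs_self (2 * C)
    rw [h2] at h1
    linarith

/-- Convexity upgrades differentiability to continuous differentiability. The right-hand side of the
system is thereby continuous between switching times, which gives right derivatives at those times.
-/
theorem continuous_gradient [ProperSpace F] (hf : ConvexOn ℝ univ f) (hd : Differentiable ℝ f) :
    Continuous (gradient f) := by
  rw [continuous_iff_continuousAt]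
  intro x
  rw [Metric.continuousAt_iff]
  intro ε hε
  have h1 := (hd x).hasGradientAt.hasFDerivAt.isLittleO.def (c := ε / 8) (by positivity)
  obtain ⟨r', hr', hball⟩ := Metric.eventually_nhds_iff.1 h1
  obtain ⟨r, hr, hrr'⟩ := exists_between hr'
  obtain ⟨L, hL, hgrad⟩ := exists_norm_gradient_le hf hd (‖x‖ + r + 1)
  refine ⟨min 1 (ε * r / (16 * L)), by positivity, fun y hy => ?_⟩
  rw [lt_min_iff, dist_eq_norm] at hy
  obtain ⟨hy1, hy2⟩ := hy
  rw [lt_div_iff₀ (by positivity)] at hy2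
  rw [dist_eq_norm]
  set v := gradient f y - gradient f x with hv
  rcases eq_or_ne v 0 with h0 | h0
  · rw [h0, norm_zero]; exact hε
  have hn : 0 < ‖v‖ := norm_pos_iff.2 h0
  -- Test the gradient inequality at `y` in the direction of the difference `v` of gradients.
  -- Replacing `y` by `x` in both values of `f` costs `2 * L * ‖y - x‖`, and differentiability at
  -- `x` bounds the rest by `r * ε / 8`.
  set e : F := (r * ‖v‖⁻¹) • v with he_def
  have he : ‖e‖ = r := by
    rw [he_def, norm_smul, norm_mul, norm_inv, norm_norm, Real.norm_eq_abs, abs_of_pos hr]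
    field_simp
  have hve : inner ℝ v e = r * ‖v‖ := by
    rw [he_def, inner_smul_right, real_inner_self_eq_norm_sq]
    field_simp
  have h2 := inner_gradient_le hf hd y (y + e)
  have h3 := inner_gradient_le hf hd (y + e) (x + e)
  have h4 := inner_gradient_le hf hd x y
  have h4' := inner_gradient_le hf hd y x
  have hyn : ‖y‖ ≤ ‖x‖ + 1 := by
    have := norm_add_le x (y - x)
    rw [add_sub_cancel] at this
    linarith
  have hb1 : |inner ℝ (gradient f (y + e)) (x + e - (y + e))| ≤ L * ‖y - x‖ := by
    refine (abs_real_inner_le_norm _ _).trans ?_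
    rw [add_sub_add_right_eq_sub, norm_sub_rev x y]
    gcongr
    exact hgrad _ (by linarith [norm_add_le y e])
  have hb2 : |inner ℝ (gradient f y) (x - y)| ≤ L * ‖y - x‖ := by
    refine (abs_real_inner_le_norm _ _).trans ?_
    rw [norm_sub_rev x y]
    gcongr
    exact hgrad _ (by linarith)
  have hb3 : |inner ℝ (gradient f x) (y - x)| ≤ L * ‖y - x‖ := by
    refine (abs_real_inner_le_norm _ _).trans ?_
    gcongr
    exact hgrad _ (by linarith)
  have h5 := hball (y := x + e) (by rw [dist_eq_norm, add_sub_cancel_left, he]; exact hrr')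
  rw [add_sub_cancel_left, he, Real.norm_eq_abs] at h5
  simp only [InnerProductSpace.toDual_apply_apply] at h5
  rw [add_sub_cancel_left] at h2
  rw [hv, inner_sub_left] at hve
  have h5' := (abs_le.1 h5).2
  have hb1' := abs_le.1 hb1
  have hb2' := abs_le.1 hb2
  have hb3' := abs_le.1 hb3
  have h6 : r * ‖v‖ < r * ε := by nlinarith
  exact lt_of_mul_lt_mul_left h6 hr.le

/-- A differentiable convex function whose set of critical points is nonempty and bounded grows
at least linearly. -/
theorem exists_linear_growth [ProperSpace F] (hf : ConvexOn ℝ univ f) (hd : Differentiable ℝ f)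
    (hne : {s | gradient f s = 0}.Nonempty) (hb : Bornology.IsBounded {s | gradient f s = 0}) :
    ∃ α > 0, ∃ β, ∀ x, α * ‖x‖ - β ≤ f x := by
  obtain ⟨p, hp⟩ := hne
  have hmin : ∀ x, f p ≤ f x := fun x => by
    have := inner_gradient_le hf hd p x
    rw [show gradient f p = 0 from hp, inner_zero_left] at this
    linarith
  obtain ⟨R, hR, hRb⟩ := hb.exists_pos_norm_lt
  -- The sphere of radius `r` about the minimizer `p` avoids all critical points, so `f` exceeds `f
  -- p` there by a uniform `c`; convexity along rays from `p` propagates this linearly.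
  set r := R + ‖p‖ with hr
  have hrpos : 0 < r := by positivity
  have hlt : ∀ x ∈ Metric.sphere p r, f p < f x := by
    intro x hx
    refine (hmin x).lt_of_ne fun heq => ?_
    have hloc : IsLocalMin f x := Eventually.of_forall fun y => heq ▸ hmin y
    have h0 : gradient f x = 0 := by
      rw [gradient, hloc.fderiv_eq_zero, map_zero]
    have h1 := hRb x h0
    rw [mem_sphere_iff_norm] at hx
    linarith [norm_sub_le x p]
  obtain ⟨c, hc, hcb⟩ : ∃ c > 0, ∀ x ∈ Metric.sphere p r, f p + c ≤ f x := by
    rcases (Metric.sphere p r).eq_empty_or_nonempty with he | hne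
    · exact ⟨1, one_pos, by simp [he]⟩
    · obtain ⟨x₀, hx₀, hm⟩ := (isCompact_sphere p r).exists_isMinOn hne hd.continuous.continuousOn
      exact ⟨f x₀ - f p, by linarith [hlt x₀ hx₀], fun x hx => by
        have := hm hx
        simp only [mem_ofPred_eq] at this
        linarith⟩
  refine ⟨c / r, by positivity, c / r * ‖p‖ + c - f p, fun x => ?_⟩
  have hxp : ‖x‖ ≤ ‖x - p‖ + ‖p‖ := by
    have := norm_add_le (x - p) p
    rwa [sub_add_cancel] at this
  have h1 : c / r * ‖x‖ ≤ c / r * ‖x - p‖ + c / r * ‖p‖ := by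
    rw [← mul_add]; gcongr
  rcases le_or_gt ‖x - p‖ r with hle | hgt
  · have h2 : c / r * ‖x - p‖ ≤ c := by
      rw [div_mul_eq_mul_div, div_le_iff₀ hrpos]; gcongr
    linarith [hmin x]
  · set d := ‖x - p‖
    have hd0 : 0 < d := hrpos.trans hgt
    have hs : p + (r / d) • (x - p) ∈ Metric.sphere p r := by
      rw [mem_sphere_iff_norm, add_sub_cancel_left, norm_smul, Real.norm_eq_abs,
        abs_of_pos (by positivity)]
      field_simp
      rfl
    have h2 := hcb _ hs
    have hrd : r / d ≤ 1 := (div_le_one hd0).2 hgt.le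
    have h3 := hf.2 (mem_univ p) (mem_univ x) (sub_nonneg.2 hrd)
      (show 0 ≤ r / d by positivity) (sub_add_cancel _ _)
    have h4 : (1 - r / d) • p + (r / d) • x = p + (r / d) • (x - p) := by module
    rw [h4, smul_eq_mul, smul_eq_mul] at h3
    have h5 : c ≤ r / d * (f x - f p) := by linarith
    have h6 : c / r * d ≤ f x - f p := by
      rw [div_mul_eq_mul_div, div_le_iff₀ hrpos]
      have : r / d * (f x - f p) * d = (f x - f p) * r := by field_simp
      nlinarith
    linarith

end ConvexFunctions

/-! ### The projection -/

section MetricProj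

variable {m : ℕ} {C : Set (E m)}

theorem inner_sub_metricProj_le (hC : IsClosed C) (hconv : Convex ℝ C) (s : E m) {z : E m}
    (hz : z ∈ C) : inner ℝ (s - metricProj C s) (z - metricProj C s) ≤ 0 := by
  obtain ⟨hp, hmin⟩ := metricProj_spec ⟨z, hz⟩ hC s
  have : Nonempty C := ⟨⟨z, hz⟩⟩
  refine (norm_eq_iInf_iff_real_inner_le_zero hconv hp).1 (le_antisymm ?_ ?_) z hz
  · exact le_ciInf fun w => hmin w w.2
  · exact ciInf_le ⟨0, by rintro _ ⟨w, rfl⟩; exact norm_nonneg _⟩ (⟨_, hp⟩ : C)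

theorem norm_sub_metricProj_sq_le (hC : IsClosed C) (hconv : Convex ℝ C) (s : E m) {z : E m}
    (hz : z ∈ C) : ‖s - metricProj C s‖ ^ 2 ≤ inner ℝ (s - z) (s - metricProj C s) := by
  have h := inner_sub_metricProj_le hC hconv s hz
  have h1 : s - z = (s - metricProj C s) - (z - metricProj C s) := by abel
  rw [h1, inner_sub_left, real_inner_self_eq_norm_sq, real_inner_comm]
  linarith

theorem norm_metricProj_sub_le (hne : C.Nonempty) (hC : IsClosed C) (hconv : Convex ℝ C)
    (s t : E m) : ‖metricProj C s - metricProj C t‖ ≤ ‖s - t‖ := by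
  have h1 := inner_sub_metricProj_le hC hconv s (metricProj_spec hne hC t).1
  have h2 := inner_sub_metricProj_le hC hconv t (metricProj_spec hne hC s).1
  set p := metricProj C s
  set r := metricProj C t
  have h3 : inner ℝ (s - t) (p - r) = ‖p - r‖ ^ 2 - inner ℝ (s - p) (r - p)
      - inner ℝ (t - r) (p - r) := by
    rw [← real_inner_self_eq_norm_sq, ← neg_sub p r, inner_neg_right]
    simp only [inner_sub_left, inner_sub_right]
    ring
  have h4 := real_inner_le_norm (s - t) (p - r)
  rcases (norm_nonneg (p - r)).eq_or_lt with h0 | h0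
  · rw [← h0]; exact norm_nonneg _
  · nlinarith

theorem continuous_metricProj (hne : C.Nonempty) (hC : IsClosed C) (hconv : Convex ℝ C) :
    Continuous (metricProj C) := by
  refine (LipschitzWith.of_dist_le_mul (K := 1) fun s t => ?_).continuous
  rw [NNReal.coe_one, one_mul, dist_eq_norm, dist_eq_norm]
  exact norm_metricProj_sub_le hne hC hconv s t

end MetricProj

/-! ### Sequences of times and growth from right derivatives -/

theorem exists_mem_Ico_of_tendsto {s : ℕ → ℝ} {t : ℝ} (h0 : s 0 ≤ t) (hs : Tendsto s atTop atTop) :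
    ∃ k, t ∈ Ico (s k) (s (k + 1)) := by
  classical
  have hex : ∃ k, t < s k := (hs.eventually_gt_atTop t).exists
  obtain ⟨k, hk⟩ : ∃ k, Nat.find hex = k + 1 :=
    Nat.exists_eq_succ_of_ne_zero fun h => absurd (h ▸ Nat.find_spec hex) (not_lt.2 h0)
  exact ⟨k, not_lt.1 (Nat.find_min hex (by omega)), hk ▸ Nat.find_spec hex⟩

theorem tendsto_atTop_of_le_sub {s : ℕ → ℝ} {d : ℝ} (hd : 0 < d) (hs : ∀ k, d ≤ s (k + 1) - s k) :
    Tendsto s atTop atTop := by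
  have h : ∀ k : ℕ, s 0 + k * d ≤ s k := by
    intro k
    induction k with
    | zero => simp
    | succ k ih => push_cast; linarith [hs k]
  exact tendsto_atTop_mono h
    (tendsto_atTop_add_const_left _ _ (tendsto_natCast_atTop_atTop.atTop_mul_const hd))

/-- A function whose right derivative is at least `c` grows at least at the rate `c`. -/
theorem mul_sub_le_of_le_deriv_right {φ φ' : ℝ → ℝ} {a b c : ℝ} (hab : a ≤ b)
    (hφ : ContinuousOn φ (Icc a b)) (hφ' : ∀ t ∈ Ico a b, HasDerivWithinAt φ (φ' t) (Ici t) t)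
    (hc : ∀ t ∈ Ico a b, c ≤ φ' t) : c * (b - a) ≤ φ b - φ a := by
  have h := image_le_of_deriv_right_le_deriv_boundary (f := fun t => φ a + c * (t - a))
    (f' := fun _ => c) (by fun_prop)
    (fun t _ => by
      simpa using (((hasDerivWithinAt_id t (Ici t)).sub_const a).const_mul c).const_add (φ a))
    (by simp) hφ hφ' hc (right_mem_Icc.2 hab)
  linarith

/-! ### Sums of squared distances -/

section SqSum

variable {n m : ℕ}

/-- The sum of the squared distances of the points `X i` to the point `z`. -/
noncomputable def sqSum (z : E m) (X : Fin n → E m) : ℝ := ∑ i, ‖X i - z‖ ^ 2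

/-- The sum of the squared distances of the points `X i` to the projection of their average, which
is the squared distance of the tuple `X` to the constant tuples with value in `C`. -/
noncomputable def sqDist (C : Set (E m)) (X : Fin n → E m) : ℝ :=
  sqSum (metricProj C (average X)) X

theorem sqSum_nonneg (z : E m) (X : Fin n → E m) : 0 ≤ sqSum z X :=
  Finset.sum_nonneg fun _ _ => by positivity

theorem sq_norm_sub_le_sqSum (z : E m) (X : Fin n → E m) (i : Fin n) :
    ‖X i - z‖ ^ 2 ≤ sqSum z X :=
  Finset.single_le_sum (f := fun i => ‖X i - z‖ ^ 2) (fun _ _ => by positivity)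
    (Finset.mem_univ i)

theorem sqDist_nonneg (C : Set (E m)) (X : Fin n → E m) : 0 ≤ sqDist C X := sqSum_nonneg _ _

theorem eq_of_sqSum_eq_zero {z : E m} {X : Fin n → E m} (h : sqSum z X = 0) (i : Fin n) :
    X i = z := by
  have := sq_norm_sub_le_sqSum z X i
  rw [h] at this
  exact sub_eq_zero.1 (norm_eq_zero.1 (pow_eq_zero_iff two_ne_zero |>.1
    (le_antisymm this (by positivity))))

theorem sum_sub_average (hn : 0 < n) (X : Fin n → E m) : ∑ i, (X i - average X) = 0 := by
  have : (n : ℝ) ≠ 0 := by positivity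
  rw [Finset.sum_sub_distrib, Finset.sum_const, Finset.card_univ, Fintype.card_fin, average,
    ← Nat.cast_smul_eq_nsmul ℝ, smul_smul, mul_one_div_cancel this, one_smul, sub_self]

/-- Parallel axis identity: the deviations from the average sum to zero, so the cross terms vanish.
Hence the best common point in `C` is the projection of the average. -/
theorem sqSum_eq (hn : 0 < n) (z : E m) (X : Fin n → E m) :
    sqSum z X = sqSum (average X) X + n * ‖average X - z‖ ^ 2 := by
  have h : ∀ i, ‖X i - z‖ ^ 2 = ‖X i - average X‖ ^ 2
      + 2 * inner ℝ (X i - average X) (average X - z) + ‖average X - z‖ ^ 2 := fun i => by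
    rw [← norm_add_sq_real, sub_add_sub_cancel]
  simp only [sqSum, h, Finset.sum_add_distrib, ← Finset.mul_sum, ← sum_inner,
    sum_sub_average hn, inner_zero_left]
  simp

theorem norm_average_le (hn : 0 < n) {X : Fin n → E m} {R : ℝ} (h : ∀ i, ‖X i‖ ≤ R) :
    ‖average X‖ ≤ R := by
  have hn' : (0 : ℝ) < n := by positivity
  rw [average, norm_smul, Real.norm_eq_abs, abs_of_pos (by positivity), one_div,
    inv_mul_le_iff₀ hn']
  refine (norm_sum_le _ _).trans ((Finset.sum_le_sum fun i _ => h i).trans ?_)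
  simp

theorem continuous_average : Continuous (average : (Fin n → E m) → E m) := by
  unfold average
  fun_prop

theorem sqSum_average_le_sqDist (hn : 0 < n) (C : Set (E m)) (X : Fin n → E m) :
    sqSum (average X) X ≤ sqDist C X := by
  rw [sqDist, sqSum_eq hn (metricProj C _)]
  have : 0 ≤ n * ‖average X - metricProj C (average X)‖ ^ 2 := by positivity
  linarith

/-- This allows the nearest point to be frozen at one time: the sum of squares to it then dominates
`sqDist` at all times, so the moving projection is never differentiated. -/
theorem sqDist_le_sqSum (hn : 0 < n) {C : Set (E m)} (hC : IsClosed C) {z : E m} (hz : z ∈ C)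
    (X : Fin n → E m) : sqDist C X ≤ sqSum z X := by
  rw [sqDist, sqSum_eq hn, sqSum_eq hn z]
  have h := (metricProj_spec ⟨z, hz⟩ hC (average X)).2 z hz
  gcongr

theorem continuous_sqDist {C : Set (E m)} (hne : C.Nonempty) (hC : IsClosed C)
    (hconv : Convex ℝ C) : Continuous (sqDist C : (Fin n → E m) → ℝ) := by
  have h := (continuous_metricProj hne hC hconv).comp (continuous_average (n := n) (m := m))
  unfold sqDist sqSum
  simp only [Function.comp_def] at h
  fun_prop

end SqSum

/-! ### Dissipation of the closed loop -/

section Dissipation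

variable {n m : ℕ} {η : ℝ}

theorem CommGraph.a_nonneg (hη : 0 < η) (G : CommGraph n η) (i j : Fin n) : 0 ≤ G.a i j := by
  by_cases h : G.Adj j i
  · exact hη.le.trans (G.le_a i j h)
  · exact (G.a_eq_zero i j h).ge

theorem control_eq (f : Fin n → E m → ℝ) (H : Fin n → Set (E m)) (G : CommGraph n η)
    (X : Fin n → E m) (q : Fin n → ℝ) (i : Fin n) :
    control f H G X q i = ∑ j, G.a i j • (X j - X i) - (X i - metricProj (H i) (X i))
      - (1 / Real.sqrt (q i)) • gradient (f i) (X i) := by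
  classical
  rw [control]
  congr 2
  refine Finset.sum_subset (Finset.subset_univ _) fun j _ hj => ?_
  have : ¬ G.Adj j i := by simpa [CommGraph.neighbors] using hj
  rw [G.a_eq_zero i j this, zero_smul]

/-- The disagreement of neighbouring agents plus the squared distances to the constraint sets. -/
noncomputable def dissipation (H : Fin n → Set (E m)) (G : CommGraph n η) (X : Fin n → E m) : ℝ :=
  ∑ i, ∑ j, G.a i j * ‖X j - X i‖ ^ 2 + ∑ i, ‖X i - metricProj (H i) (X i)‖ ^ 2

theorem sum_mul_sq_le_dissipation (hη : 0 < η) (H : Fin n → Set (E m)) (G : CommGraph n η)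
    (X : Fin n → E m) (i : Fin n) : ∑ j, G.a i j * ‖X j - X i‖ ^ 2 ≤ dissipation H G X := by
  have h1 := Finset.single_le_sum (f := fun i => ∑ j, G.a i j * ‖X j - X i‖ ^ 2)
    (fun i _ => Finset.sum_nonneg fun j _ => mul_nonneg (G.a_nonneg hη i j) (sq_nonneg _))
    (Finset.mem_univ i)
  have h2 : 0 ≤ ∑ i, ‖X i - metricProj (H i) (X i)‖ ^ 2 :=
    Finset.sum_nonneg fun _ _ => sq_nonneg _
  simp only [dissipation] at h1 ⊢
  linarith

theorem mul_sq_le_dissipation (hη : 0 < η) (H : Fin n → Set (E m)) (G : CommGraph n η)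
    (X : Fin n → E m) (i j : Fin n) : G.a i j * ‖X j - X i‖ ^ 2 ≤ dissipation H G X :=
  (Finset.single_le_sum (f := fun j => G.a i j * ‖X j - X i‖ ^ 2)
    (fun j _ => mul_nonneg (G.a_nonneg hη i j) (sq_nonneg _)) (Finset.mem_univ j)).trans
    (sum_mul_sq_le_dissipation hη H G X i)

theorem sq_norm_sub_metricProj_le_dissipation (hη : 0 < η) (H : Fin n → Set (E m))
    (G : CommGraph n η) (X : Fin n → E m) (i : Fin n) :
    ‖X i - metricProj (H i) (X i)‖ ^ 2 ≤ dissipation H G X := by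
  have h1 := Finset.single_le_sum (f := fun i => ‖X i - metricProj (H i) (X i)‖ ^ 2)
    (fun _ _ => sq_nonneg _) (Finset.mem_univ i)
  have h2 : 0 ≤ ∑ i, ∑ j, G.a i j * ‖X j - X i‖ ^ 2 :=
    Finset.sum_nonneg fun i _ => Finset.sum_nonneg fun j _ =>
      mul_nonneg (G.a_nonneg hη i j) (sq_nonneg _)
  simp only [dissipation] at h1 ⊢
  linarith

theorem dissipation_nonneg (hη : 0 < η) (H : Fin n → Set (E m)) (G : CommGraph n η)
    (X : Fin n → E m) : 0 ≤ dissipation H G X :=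
  add_nonneg (Finset.sum_nonneg fun i _ => Finset.sum_nonneg fun j _ =>
      mul_nonneg (G.a_nonneg hη i j) (sq_nonneg _)) (Finset.sum_nonneg fun _ _ => sq_nonneg _)

/-- Along a balanced graph, the coupling dissipates the sum of squared distances to any point. -/
theorem CommGraph.Balanced.sum_inner_eq {G : CommGraph n η} (hG : G.Balanced) (X : Fin n → E m)
    (z : E m) : 2 * ∑ i, inner ℝ (X i - z) (∑ j, G.a i j • (X j - X i)) =
      -∑ i, ∑ j, G.a i j * ‖X j - X i‖ ^ 2 := by
  have h : ∀ i j, 2 * (G.a i j * inner ℝ (X i - z) (X j - X i)) =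
      G.a i j * ‖X j - z‖ ^ 2 - G.a i j * ‖X i - z‖ ^ 2 - G.a i j * ‖X j - X i‖ ^ 2 := by
    intro i j
    have : ‖X j - z‖ ^ 2 = ‖X i - z‖ ^ 2 + 2 * inner ℝ (X i - z) (X j - X i)
        + ‖X j - X i‖ ^ 2 := by
      rw [← norm_add_sq_real]
      congr 2
      abel
    rw [this]
    ring
  simp only [inner_sum, inner_smul_right, Finset.mul_sum, h, Finset.sum_sub_distrib]
  -- After exchanging the sums, this is the equality of column and row sums, that is, balance.
  have h1 : ∑ i, ∑ j, G.a i j * ‖X j - z‖ ^ 2 = ∑ i, ∑ j, G.a i j * ‖X i - z‖ ^ 2 := by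
    rw [Finset.sum_comm]
    refine Finset.sum_congr rfl fun i _ => ?_
    rw [← Finset.sum_mul, ← Finset.sum_mul, hG i]
  rw [h1, sub_self, zero_sub]

/-- The basic Lyapunov inequality. Coupling gives exactly minus the weighted disagreement, the
projection terms give at least twice what the dissipation counts, and convexity bounds the gradient
terms. -/
theorem two_mul_sum_inner_control_le {f : Fin n → E m → ℝ} {H : Fin n → Set (E m)}
    (hf_conv : ∀ i, ConvexOn ℝ univ (f i)) (hf_diff : ∀ i, Differentiable ℝ (f i))
    (hH_closed : ∀ i, IsClosed (H i)) (hH_conv : ∀ i, Convex ℝ (H i))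
    {G : CommGraph n η} (hG : G.Balanced) (X : Fin n → E m) (q : Fin n → ℝ) {z : E m}
    (hz : z ∈ ⋂ i, H i) :
    2 * ∑ i, inner ℝ (X i - z) (control f H G X q i) ≤
      -dissipation H G X + 2 * ∑ i, 1 / Real.sqrt (q i) * (f i z - f i (X i)) := by
  have h1 := hG.sum_inner_eq X z
  have h2 : ∑ i, ‖X i - metricProj (H i) (X i)‖ ^ 2 ≤
      ∑ i, inner ℝ (X i - z) (X i - metricProj (H i) (X i)) :=
    Finset.sum_le_sum fun i _ =>
      norm_sub_metricProj_sq_le (hH_closed i) (hH_conv i) _ (mem_iInter.1 hz i)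
  have h3 : -∑ i, inner ℝ (X i - z) ((1 / Real.sqrt (q i)) • gradient (f i) (X i)) ≤
      ∑ i, 1 / Real.sqrt (q i) * (f i z - f i (X i)) := by
    rw [← Finset.sum_neg_distrib]
    refine Finset.sum_le_sum fun i _ => ?_
    rw [inner_smul_right, real_inner_comm, ← mul_neg, ← inner_neg_right, neg_sub]
    exact mul_le_mul_of_nonneg_left (inner_gradient_le (hf_conv i) (hf_diff i) _ _)
      (by positivity)
  have h4 : 0 ≤ ∑ i, ‖X i - metricProj (H i) (X i)‖ ^ 2 :=
    Finset.sum_nonneg fun _ _ => sq_nonneg _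
  simp only [control_eq, inner_sub_right (𝕜 := ℝ) _ (_ - _) _,
    inner_sub_right (𝕜 := ℝ) _ (Finset.sum _ _) _, Finset.sum_sub_distrib, dissipation]
  linarith

/-- Bound of the velocity of an agent in a direction `w` in which the coupling terms are controlled
by squared distances. -/
theorem inner_control_le (hη : 0 < η) (f : Fin n → E m → ℝ) (H : Fin n → Set (E m))
    (G : CommGraph n η) (X : Fin n → E m) (q : Fin n → ℝ) {k : Fin n} {w : E m} (hw : ‖w‖ ≤ 1)
    {c : ℝ} (hc : ∀ j, inner ℝ w (X j - X k) ≤ c * ‖X j - X k‖ ^ 2) :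
    inner ℝ w (control f H G X q k) ≤ c * ∑ j, G.a k j * ‖X j - X k‖ ^ 2
      + ‖X k - metricProj (H k) (X k)‖ + ‖(1 / Real.sqrt (q k)) • gradient (f k) (X k)‖ := by
  have hle : ∀ y : E m, -inner ℝ w y ≤ ‖y‖ := fun y => by
    have h1 := (abs_le.1 (abs_real_inner_le_norm w y)).1
    nlinarith [norm_nonneg y]
  have h1 : inner ℝ w (∑ j, G.a k j • (X j - X k)) ≤ c * ∑ j, G.a k j * ‖X j - X k‖ ^ 2 := by
    rw [inner_sum, Finset.mul_sum]
    refine Finset.sum_le_sum fun j _ => ?_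
    rw [inner_smul_right]
    nlinarith [mul_le_mul_of_nonneg_left (hc j) (G.a_nonneg hη k j)]
  rw [control_eq, inner_sub_right, inner_sub_right]
  linarith [hle (X k - metricProj (H k) (X k)),
    hle ((1 / Real.sqrt (q k)) • gradient (f k) (X k))]

end Dissipation

/-- A trajectory of the closed-loop system for convex data and a balanced, jointly strongly
connected communication graph. -/
structure ClosedLoop {n m : ℕ} {η : ℝ} (f : Fin n → E m → ℝ) (H : Fin n → Set (E m)) (dw M : ℝ)
    (G : ℝ → CommGraph n η) (σ : ℕ → ℝ) (x : Fin n → ℝ → E m) (q : Fin n → ℝ → ℝ) : Prop where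
  n_pos : 0 < n
  f_diff : ∀ i, Differentiable ℝ (f i)
  f_conv : ∀ i, ConvexOn ℝ univ (f i)
  H_closed : ∀ i, IsClosed (H i)
  H_conv : ∀ i, Convex ℝ (H i)
  crit_nonempty : ∀ i, {s | gradient (f i) s = 0}.Nonempty
  crit_bounded : ∀ i, Bornology.IsBounded {s | gradient (f i) s = 0}
  H_nonempty : (⋂ i, H i).Nonempty
  η_pos : 0 < η
  dw_pos : 0 < dw
  M_pos : 0 < M
  balanced : ∀ t, 0 ≤ t → (G t).Balanced
  switching : IsSwitchingSequence G dw σ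
  connected : JointlyStronglyConnected G σ M
  traj : IsTrajectory f H G σ x q

namespace ClosedLoop

variable {n m : ℕ} {η : ℝ} {f : Fin n → E m → ℝ} {H : Fin n → Set (E m)} {dw M : ℝ}
  {G : ℝ → CommGraph n η} {σ : ℕ → ℝ} {x : Fin n → ℝ → E m} {q : Fin n → ℝ → ℝ}

/-! ### Switching times -/

theorem strictMono_switching (h : ClosedLoop f H dw M G σ x q) : StrictMono σ :=
  strictMono_nat_of_lt_succ fun k => by linarith [h.switching.dwell k, h.dw_pos]

theorem switching_nonneg (h : ClosedLoop f H dw M G σ x q) (k : ℕ) : 0 ≤ σ k := by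
  rw [← h.switching.zero]
  exact h.strictMono_switching.monotone k.zero_le

theorem tendsto_switching (h : ClosedLoop f H dw M G σ x q) : Tendsto σ atTop atTop :=
  tendsto_atTop_of_le_sub h.dw_pos h.switching.dwell

theorem exists_mem_Ico_switching (h : ClosedLoop f H dw M G σ x q) {t : ℝ} (ht : 0 ≤ t) :
    ∃ k, t ∈ Ico (σ k) (σ (k + 1)) :=
  exists_mem_Ico_of_tendsto (h.switching.zero.trans_le ht) h.tendsto_switching

/-! ### The gain variables -/

theorem gain_zero_pos (h : ClosedLoop f H dw M G σ x q) (i : Fin n) : 0 < q i 0 :=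
  h.traj.3 i

theorem hasDerivWithinAt_gain (h : ClosedLoop f H dw M G σ x q) (i : Fin n) {t : ℝ} (ht : 0 ≤ t) :
    HasDerivWithinAt (q i) (Real.arctan (Real.exp ‖x i t‖)) (Ici t) t :=
  (h.traj.q_deriv i t ht).mono (Ici_subset_Ici.2 ht)

theorem continuousOn_gain (h : ClosedLoop f H dw M G σ x q) (i : Fin n) :
    ContinuousOn (q i) (Ici 0) :=
  fun t ht => (h.traj.q_deriv i t ht).continuousWithinAt

/-- Since `exp ‖x‖ ≥ 1`, the rate is at least `arctan 1 = π / 4`, whatever the state does. -/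
theorem gain_lower (h : ClosedLoop f H dw M G σ x q) (i : Fin n) {t : ℝ} (ht : 0 ≤ t) :
    q i 0 + Real.pi / 4 * t ≤ q i t := by
  have := mul_sub_le_of_le_deriv_right (c := Real.pi / 4) ht
    ((h.continuousOn_gain i).mono Icc_subset_Ici_self)
    (fun s hs => h.hasDerivWithinAt_gain i hs.1) fun s _ => by
      rw [← Real.arctan_one]
      exact Real.arctan_strictMono.monotone (Real.one_le_exp (norm_nonneg _))
  linarith

theorem gain_upper (h : ClosedLoop f H dw M G σ x q) (i : Fin n) {t : ℝ} (ht : 0 ≤ t) :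
    q i t ≤ q i 0 + Real.pi / 2 * t := by
  have := mul_sub_le_of_le_deriv_right (c := -(Real.pi / 2)) ht
    ((h.continuousOn_gain i).mono Icc_subset_Ici_self).neg
    (fun s hs => (h.hasDerivWithinAt_gain i hs.1).neg) fun s _ => by
      exact neg_le_neg (Real.arctan_lt_pi_div_two _).le
  simp only [Pi.neg_apply] at this
  linarith

theorem gain_pos (h : ClosedLoop f H dw M G σ x q) (i : Fin n) {t : ℝ} (ht : 0 ≤ t) :
    0 < q i t := by
  have := h.gain_lower i ht
  have := h.gain_zero_pos i
  have := Real.pi_pos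
  have : 0 ≤ Real.pi / 4 * t := by positivity
  linarith

/-- All gains `q i` grow linearly. -/
theorem exists_gain_bounds (h : ClosedLoop f H dw M G σ x q) :
    ∃ c₁ > 0, ∃ c₂ > 0, ∀ i, ∀ t, 0 ≤ t → c₁ * (1 + t) ≤ q i t ∧ q i t ≤ c₂ * (1 + t) := by
  have : Nonempty (Fin n) := ⟨⟨0, h.n_pos⟩⟩
  obtain ⟨i₀, -, hmin⟩ := Finset.univ.exists_min_image (fun i => q i 0) Finset.univ_nonempty
  obtain ⟨i₁, -, hmax⟩ := Finset.univ.exists_max_image (fun i => q i 0) Finset.univ_nonempty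
  have hpi := Real.pi_pos
  refine ⟨min (q i₀ 0) (Real.pi / 4), lt_min (h.gain_zero_pos i₀) (by positivity),
    max (q i₁ 0) (Real.pi / 2), lt_max_of_lt_left (h.gain_zero_pos i₁), fun i t ht => ⟨?_, ?_⟩⟩
  · have h1 := h.gain_lower i ht
    have h2 := hmin i (Finset.mem_univ i)
    have h3 := min_le_left (q i₀ 0) (Real.pi / 4)
    have h4 := mul_le_mul_of_nonneg_right (min_le_right (q i₀ 0) (Real.pi / 4)) ht
    linarith
  · have h1 := h.gain_upper i ht
    have h2 := hmax i (Finset.mem_univ i)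
    have h3 := le_max_left (q i₁ 0) (Real.pi / 2)
    have h4 := mul_le_mul_of_nonneg_right (le_max_right (q i₁ 0) (Real.pi / 2)) ht
    linarith

/-- The common time scale `1 / √(1 + t)` of the step sizes `1 / √(q i t)`. -/
noncomputable def scale (t : ℝ) : ℝ := 1 / Real.sqrt (1 + t)

theorem scale_pos {t : ℝ} (ht : 0 ≤ t) : 0 < scale t := by
  unfold scale; positivity

theorem scale_anti {s t : ℝ} (hs : 0 ≤ s) (hst : s ≤ t) : scale t ≤ scale s := by
  unfold scale
  have : 0 < Real.sqrt (1 + s) := by positivity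
  gcongr

theorem tendsto_sqrt_one_add : Tendsto (fun t : ℝ => Real.sqrt (1 + t)) atTop atTop :=
  Real.tendsto_sqrt_atTop.comp (tendsto_atTop_add_const_left _ 1 tendsto_id)

theorem tendsto_scale : Tendsto scale atTop (𝓝 0) := by
  unfold scale
  simp only [one_div]
  exact tendsto_inv_atTop_zero.comp tendsto_sqrt_one_add

theorem exists_step_bounds (h : ClosedLoop f H dw M G σ x q) :
    ∃ c₁ > 0, ∃ c₂ > 0, ∀ i, ∀ t, 0 ≤ t →
      c₁ * scale t ≤ 1 / Real.sqrt (q i t) ∧ 1 / Real.sqrt (q i t) ≤ c₂ * scale t := by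
  obtain ⟨c₁, hc₁, c₂, hc₂, hb⟩ := h.exists_gain_bounds
  refine ⟨1 / Real.sqrt c₂, by positivity, 1 / Real.sqrt c₁, by positivity, fun i t ht => ?_⟩
  obtain ⟨h1, h2⟩ := hb i t ht
  have hq : 0 < Real.sqrt (q i t) := Real.sqrt_pos.2 (h.gain_pos i ht)
  rw [scale, div_mul_div_comm, div_mul_div_comm, ← Real.sqrt_mul hc₁.le, ← Real.sqrt_mul hc₂.le,
    one_mul]
  have h3 : 0 < Real.sqrt (c₁ * (1 + t)) := by positivity
  constructor <;> gcongr

/-! ### One-sided derivatives -/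

/-- At time zero and at switching times no equation is assumed. The graph is constant just to the
right of `t`, so the derivatives there converge to the control at `t`, and their limit is the right
derivative. -/
theorem hasDerivWithinAt_state (h : ClosedLoop f H dw M G σ x q) (i : Fin n) {t : ℝ} (ht : 0 ≤ t) :
    HasDerivWithinAt (x i) (control f H (G t) (fun j => x j t) (fun j => q j t) i) (Ici t) t := by
  obtain ⟨k, hk⟩ := h.exists_mem_Ico_switching ht
  have hder : ∀ s ∈ Ioo t (σ (k + 1)),
      HasDerivAt (x i) (control f H (G t) (fun j => x j s) (fun j => q j s) i) s := by
    intro s hs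
    have h1 : s ∉ range σ := by
      rintro ⟨l, rfl⟩
      have h2 := h.strictMono_switching.lt_iff_lt.1 (hk.1.trans_lt hs.1)
      have h3 := h.strictMono_switching.lt_iff_lt.1 hs.2
      omega
    have h2 := h.traj.x_deriv i s (ht.trans_lt hs.1) h1
    rwa [h.switching.const k s ⟨hk.1.trans hs.1.le, hs.2⟩, ← h.switching.const k t hk] at h2
  have hmem : Ioo t (σ (k + 1)) ∈ 𝓝[>] t := Ioo_mem_nhdsGT hk.2
  have hsub : Ioo t (σ (k + 1)) ⊆ Ici 0 := fun s hs => ht.trans hs.1.le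
  have hx : ∀ j, ContinuousWithinAt (x j) (Ioi t) t := fun j =>
    (h.traj.x_cont j t ht).mono fun s hs => ht.trans (le_of_lt hs)
  have hq : ∀ j, ContinuousWithinAt (q j) (Ioi t) t := fun j =>
    (h.continuousOn_gain j t ht).mono fun s hs => ht.trans (le_of_lt hs)
  refine hasDerivWithinAt_Ici_of_tendsto_deriv
    (fun s hs => (hder s hs).differentiableAt.differentiableWithinAt)
    ((h.traj.x_cont i t ht).mono hsub) hmem ?_
  have hc : ContinuousWithinAt
      (fun s => control f H (G t) (fun j => x j s) (fun j => q j s) i) (Ioi t) t := by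
    simp only [control_eq]
    have hP : ContinuousWithinAt (fun s => metricProj (H i) (x i s)) (Ioi t) t :=
      (continuous_metricProj (h.H_nonempty.mono (iInter_subset _ i)) (h.H_closed i)
        (h.H_conv i)).continuousAt.comp_continuousWithinAt (hx i)
    have hg : ContinuousWithinAt (fun s => gradient (f i) (x i s)) (Ioi t) t :=
      (continuous_gradient (h.f_conv i) (h.f_diff i)).continuousAt.comp_continuousWithinAt (hx i)
    have hs : ContinuousWithinAt (fun s => 1 / Real.sqrt (q i s)) (Ioi t) t :=
      continuousWithinAt_const.div
        (Real.continuous_sqrt.continuousAt.comp_continuousWithinAt (hq i))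
        (Real.sqrt_pos.2 (h.gain_pos i ht)).ne'
    have hsum : ContinuousWithinAt (fun s => ∑ j, (G t).a i j • (x j s - x i s)) (Ioi t) t := by
      have : ∀ j ∈ Finset.univ, ContinuousWithinAt
          (fun s => (G t).a i j • (x j s - x i s)) (Ioi t) t :=
        fun j _ => by have := hx j; have := hx i; fun_prop
      exact tendsto_finsetSum _ this
    exact (hsum.sub ((hx i).sub hP)).sub (hs.smul hg)
  refine hc.congr' ?_
  filter_upwards [hmem] with s hs
  exact (hder s hs).deriv.symm

theorem hasDerivWithinAt_sqSum (h : ClosedLoop f H dw M G σ x q) (z : E m) {t : ℝ} (ht : 0 ≤ t) :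
    HasDerivWithinAt (fun t => sqSum z fun j => x j t) (2 * ∑ i, inner ℝ (x i t - z)
      (control f H (G t) (fun j => x j t) (fun j => q j t) i)) (Ici t) t := by
  unfold sqSum
  rw [Finset.mul_sum]
  have : ∀ i ∈ Finset.univ, HasDerivWithinAt (fun t => ‖x i t - z‖ ^ 2) (2 * inner ℝ (x i t - z)
      (control f H (G t) (fun j => x j t) (fun j => q j t) i)) (Ici t) t := fun i _ =>
    ((h.hasDerivWithinAt_state i ht).sub_const z).norm_sq
  exact HasDerivWithinAt.fun_sum this

theorem continuousOn_state (h : ClosedLoop f H dw M G σ x q) :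
    ContinuousOn (fun t j => x j t) (Ici 0) :=
  continuousOn_pi.2 h.traj.x_cont

theorem continuousOn_sqSum (h : ClosedLoop f H dw M G σ x q) (z : E m) :
    ContinuousOn (fun t => sqSum z fun j => x j t) (Ici 0) := by
  have : Continuous (sqSum z : (Fin n → E m) → ℝ) := by unfold sqSum; fun_prop
  exact this.comp_continuousOn h.continuousOn_state

theorem deriv_sqSum_le (h : ClosedLoop f H dw M G σ x q) {z : E m} (hz : z ∈ ⋂ i, H i) {t : ℝ}
    (ht : 0 ≤ t) :
    2 * ∑ i, inner ℝ (x i t - z) (control f H (G t) (fun j => x j t) (fun j => q j t) i) ≤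
      -dissipation H (G t) (fun j => x j t)
        + 2 * ∑ i, 1 / Real.sqrt (q i t) * (f i z - f i (x i t)) :=
  two_mul_sum_inner_control_le h.f_conv h.f_diff h.H_closed h.H_conv (h.balanced t ht) _ _ hz

/-! ### Boundedness -/

theorem exists_uniform_growth (h : ClosedLoop f H dw M G σ x q) :
    ∃ α > 0, ∃ β, ∀ i y, α * ‖y‖ - β ≤ f i y := by
  have : Nonempty (Fin n) := ⟨⟨0, h.n_pos⟩⟩
  choose α hα β hβ using fun i =>
    exists_linear_growth (h.f_conv i) (h.f_diff i) (h.crit_nonempty i) (h.crit_bounded i)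
  obtain ⟨i₀, -, hmin⟩ := Finset.univ.exists_min_image α Finset.univ_nonempty
  obtain ⟨i₁, -, hmax⟩ := Finset.univ.exists_max_image β Finset.univ_nonempty
  refine ⟨α i₀, hα i₀, β i₁, fun i y => ?_⟩
  have h1 := mul_le_mul_of_nonneg_right (hmin i (Finset.mem_univ i)) (norm_nonneg y)
  linarith [hβ i y, hmax i (Finset.mem_univ i)]

/-- If the sum of squared distances to a feasible `z` is large, some agent is far from `z`. By
linear growth its negative contribution outweighs the bounded positive ones of the others, since the
step sizes are comparable. -/
theorem exists_state_bound (h : ClosedLoop f H dw M G σ x q) :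
    ∃ R > 0, ∀ t, 0 ≤ t → ∀ i, ‖x i t‖ ≤ R := by
  obtain ⟨z, hz⟩ := h.H_nonempty
  obtain ⟨α, hα, β, hβ⟩ := h.exists_uniform_growth
  obtain ⟨c₁, hc₁, c₂, hc₂, hstep⟩ := h.exists_step_bounds
  obtain ⟨A, hA, hAz⟩ : ∃ A > 0, ∀ i y, f i z - f i y ≤ A - α * ‖y‖ := by
    refine ⟨∑ i, |f i z| + |β| + 1, by positivity, fun i y => ?_⟩
    have h1 := Finset.single_le_sum (f := fun i => |f i z|) (fun _ _ => abs_nonneg _)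
      (Finset.mem_univ i)
    linarith [hβ i y, le_abs_self (f i z), le_abs_self β]
  have hn : (0 : ℝ) < n := by exact_mod_cast h.n_pos
  -- At distance `r` from `z` one agent contributes at most `-(n * c₂ * A + c₁) * scale t`, while
  -- the others together contribute at most `n * c₂ * A * scale t`.
  set r := (n * (c₂ * A) / c₁ + 1 + A) / α + ‖z‖ with hr
  have hrpos : 0 < r := by positivity
  have hneg : ∀ t, 0 ≤ t → n * r ^ 2 ≤ sqSum z (fun j => x j t) →
      2 * ∑ i, 1 / Real.sqrt (q i t) * (f i z - f i (x i t)) < 0 := by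
    intro t ht hle
    have hg := scale_pos ht
    obtain ⟨i, hi⟩ : ∃ i, r ≤ ‖x i t - z‖ := by
      by_contra hc
      push Not at hc
      have : Nonempty (Fin n) := ⟨⟨0, h.n_pos⟩⟩
      have : sqSum z (fun j => x j t) < ∑ _i : Fin n, r ^ 2 :=
        Finset.sum_lt_sum_of_nonempty Finset.univ_nonempty fun i _ =>
          pow_lt_pow_left₀ (hc i) (norm_nonneg _) two_ne_zero
      rw [Finset.sum_const, Finset.card_univ, Fintype.card_fin, nsmul_eq_mul] at this
      linarith
    have hle1 : ∀ j, 1 / Real.sqrt (q j t) * (f j z - f j (x j t)) ≤ c₂ * scale t * A := by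
      intro j
      have h0 : 0 ≤ 1 / Real.sqrt (q j t) := by positivity
      have h1 : f j z - f j (x j t) ≤ A := by
        have : 0 ≤ α * ‖x j t‖ := by positivity
        linarith [hAz j (x j t)]
      exact (mul_le_mul_of_nonneg_left h1 h0).trans
        (mul_le_mul_of_nonneg_right (hstep j t ht).2 hA.le)
    have hi1 : 1 / Real.sqrt (q i t) * (f i z - f i (x i t)) ≤
        c₁ * scale t * -(n * (c₂ * A) / c₁ + 1) := by
      have h2 : ‖x i t - z‖ ≤ ‖x i t‖ + ‖z‖ := norm_sub_le _ _
      have h3 : (n * (c₂ * A) / c₁ + 1 + A) / α ≤ ‖x i t‖ := by linarith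
      rw [div_le_iff₀ hα] at h3
      have h4 : f i z - f i (x i t) ≤ -(n * (c₂ * A) / c₁ + 1) := by
        linarith [hAz i (x i t)]
      have h5 : 0 ≤ n * (c₂ * A) / c₁ + 1 := by positivity
      have h6 : 0 ≤ 1 / Real.sqrt (q i t) := by positivity
      nlinarith [mul_le_mul_of_nonneg_left h4 h6, (hstep i t ht).1]
    have hsum : ∑ i, 1 / Real.sqrt (q i t) * (f i z - f i (x i t)) ≤
        c₁ * scale t * -(n * (c₂ * A) / c₁ + 1) + n * (c₂ * scale t * A) := by
      rw [← Finset.add_sum_erase _ _ (Finset.mem_univ i)]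
      refine add_le_add hi1 ((Finset.sum_le_sum fun j _ => hle1 j).trans ?_)
      rw [Finset.sum_const, nsmul_eq_mul]
      gcongr
      exact (Finset.card_le_univ _).trans_eq (Fintype.card_fin n)
    have heq : c₁ * scale t * -(n * (c₂ * A) / c₁ + 1) + n * (c₂ * scale t * A) =
        -(c₁ * scale t) := by
      field_simp
      ring
    rw [heq] at hsum
    nlinarith [mul_pos hc₁ hg]
  set K := max (sqSum z fun j => x j 0) (n * r ^ 2)
  have hK : ∀ t, 0 ≤ t → sqSum z (fun j => x j t) ≤ K := by
    intro t ht
    refine forall_le_barrier (ι := Unit) (ψ := fun _ t => sqSum z fun j => x j t)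
      (ψ' := fun _ t => 2 * ∑ i, inner ℝ (x i t - z)
        (control f H (G t) (fun j => x j t) (fun j => q j t) i))
      (B := fun _ => K) (B' := fun _ => 0)
      (fun _ => (h.continuousOn_sqSum z).mono Icc_subset_Ici_self) continuousOn_const
      (fun _ s hs => h.hasDerivWithinAt_sqSum z hs.1) (fun s _ => hasDerivWithinAt_const _ _ _)
      (fun _ => le_max_left _ _) (fun s hs _ _ heq => ?_) t (right_mem_Icc.2 ht) ()
    have h1 := hneg s hs.1 ((le_max_right _ _).trans_eq heq.symm)
    have h2 := h.deriv_sqSum_le hz hs.1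
    have h3 := dissipation_nonneg h.η_pos H (G s) (fun j => x j s)
    linarith
  refine ⟨Real.sqrt K + ‖z‖ + 1, by positivity, fun t ht i => ?_⟩
  have h1 := (sq_norm_sub_le_sqSum z (fun j => x j t) i).trans (hK t ht)
  have h2 := Real.le_sqrt_of_sq_le h1
  have h3 := norm_add_le (x i t - z) z
  rw [sub_add_cancel] at h3
  linarith

/-! ### Consensus -/

/-- If the state has, in some direction `v`, a gap of length `γ` that separates the agents in `S`
from the others, and little is dissipated afterwards, the gap persists. -/
theorem gap_persists (h : ClosedLoop f H dw M G σ x q) {s b γ : ℝ} (hs : 0 ≤ s) (hγ : 0 < γ)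
    (hb : b - s ≤ 2 * M) {D D' : ℝ → ℝ} (hD : ContinuousOn D (Icc s b))
    (hD' : ∀ t ∈ Ico s b, HasDerivWithinAt D (D' t) (Ici t) t)
    (hdiss : ∀ t ∈ Ico s b, dissipation H (G t) (fun j => x j t) ≤ D' t)
    (hsmall : ∀ t ∈ Icc s b, (2 / γ + 48 * M / γ) * (D t - D s) ≤ γ / 8)
    (hgrad : ∀ t ∈ Ico s b, ∀ i,
      ‖(1 / Real.sqrt (q i t)) • gradient (f i) (x i t)‖ < γ / (48 * M))
    {v : E m} (hv : ‖v‖ ≤ 1) {S : Set (Fin n)} {c : ℝ} (hS : ∀ k ∈ S, inner ℝ v (x k s) ≤ c)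
    (hS' : ∀ k ∉ S, c + γ ≤ inner ℝ v (x k s)) {t : ℝ} (ht : t ∈ Icc s b) {k l : Fin n}
    (hk : k ∈ S) (hl : l ∉ S) : γ / 2 ≤ ‖x l t - x k t‖ := by
  classical
  have hM := h.M_pos
  set θ := γ / (48 * M) with hθ
  have hθpos : 0 < θ := by positivity
  set A := 2 / γ + 48 * M / γ with hA
  have hAθ : A = 2 / γ + 1 / θ := by rw [hA, hθ, one_div_div]
  -- With these signs and offsets, `e k * ⟨v, x k⟩ + o k` measures how far agent `k` has intruded
  -- into the gap, from either side; it starts nonpositive. A barrier of at most `γ / 4` leaves half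
  -- the gap open.
  set e : Fin n → ℝ := fun k => if k ∈ S then 1 else -1 with he
  set o : Fin n → ℝ := fun k => if k ∈ S then -c else c + γ with ho
  have hbar : ∀ t ∈ Icc s b, A * (D t - D s) + 3 * θ * (t - s) ≤ γ / 4 := by
    intro t ht
    have h1 : 3 * θ * (t - s) ≤ 3 * θ * (2 * M) := by
      have := ht.2
      gcongr
      linarith
    have h2 : 3 * θ * (2 * M) = γ / 8 := by rw [hθ]; field_simp; ring
    linarith [hsmall t ht]
  have hbd : ∀ t ∈ Icc s b, ∀ k, e k * inner ℝ v (x k t) + o k ≤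
      A * (D t - D s) + 3 * θ * (t - s) := by
    refine forall_le_barrier (ψ := fun k t => e k * inner ℝ v (x k t) + o k)
      (ψ' := fun k t => e k * inner ℝ v
        (control f H (G t) (fun j => x j t) (fun j => q j t) k))
      (B := fun t => A * (D t - D s) + 3 * θ * (t - s)) (B' := fun t => A * D' t + 3 * θ)
      (fun k => ?_) (by fun_prop) (fun k t ht => ?_) (fun t ht => ?_) (fun k => ?_) ?_
    · have : ContinuousOn (x k) (Icc s b) := (h.traj.x_cont k).mono fun t ht => hs.trans ht.1
      fun_prop
    · have h1 := (hasDerivWithinAt_const t (Ici t) v).inner ℝ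
        (h.hasDerivWithinAt_state k (hs.trans ht.1))
      simpa using (h1.const_mul (e k)).add_const (o k)
    · have h1 := ((hD' t ht).sub_const (D s)).const_mul A
      have h2 := ((hasDerivWithinAt_id t (Ici t)).sub_const s).const_mul (3 * θ)
      rw [mul_one] at h2
      exact h1.add h2
    · simp only [he, ho, sub_self, mul_zero, add_zero]
      split_ifs with hkS
      · linarith [hS k hkS]
      · linarith [hS' k hkS]
    · intro t ht hall k hkeq
      have hbt := hbar t (Ico_subset_Icc_self ht)
      have hw : ‖e k • v‖ ≤ 1 := by
        have : ‖e k‖ = 1 := by simp only [he]; split_ifs <;> simp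
        rw [norm_smul, this, one_mul]
        exact hv
      -- An agent at the barrier is foremost on its side, so it can be pulled inward only from
      -- across the gap, over a distance of at least `γ / 2`. There the linear pull is bounded by
      -- the quadratic dissipation.
      have hc : ∀ j, inner ℝ (e k • v) (x j t - x k t) ≤ 2 / γ * ‖x j t - x k t‖ ^ 2 := by
        intro j
        have h1 : inner ℝ (e k • v) (x j t - x k t) ≤ ‖x j t - x k t‖ := by
          refine (real_inner_le_norm _ _).trans ?_
          exact mul_le_of_le_one_left (norm_nonneg _) hw
        have h2 : inner ℝ (e k • v) (x j t - x k t) ≤ 0 ∨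
            γ / 2 ≤ inner ℝ (e k • v) (x j t - x k t) := by
          have hj := hall j
          rw [inner_smul_left, inner_sub_right]
          simp only [he, ho] at hj hkeq ⊢
          by_cases hkS : k ∈ S <;> by_cases hjS : j ∈ S <;>
            simp only [hkS, hjS, if_true, if_false, map_one, map_neg, one_mul, neg_mul]
              at hj hkeq ⊢
          · left; linarith
          · right; linarith
          · right; linarith
          · left; linarith
        rcases h2 with h2 | h2
        · exact h2.trans (by positivity)
        · refine h1.trans ?_
          rw [div_mul_eq_mul_div, le_div_iff₀ hγ]
          nlinarith
      have h3 := inner_control_le h.η_pos f H (G t) (fun j => x j t) (fun j => q j t) hw hc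
      have h4 := sum_mul_sq_le_dissipation h.η_pos H (G t) (fun j => x j t) k
      have h5 := sq_norm_sub_metricProj_le_dissipation h.η_pos H (G t) (fun j => x j t) k
      have h6 := hgrad t ht k
      have h7 := hdiss t ht
      -- The projection term costs `θ` plus dissipation and the gradient term less than `θ`; the
      -- slope `3 * θ` of the barrier makes the comparison strict.
      have h8 : ‖x k t - metricProj (H k) (x k t)‖ ≤
          θ + 1 / θ * ‖x k t - metricProj (H k) (x k t)‖ ^ 2 := by
        rw [one_div_mul_eq_div, ← sub_le_iff_le_add', le_div_iff₀ hθpos]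
        nlinarith [sq_nonneg (‖x k t - metricProj (H k) (x k t)‖ - θ)]
      have h9 : 2 / γ * ∑ j, (G t).a k j * ‖x j t - x k t‖ ^ 2 ≤ 2 / γ * D' t := by
        gcongr
        exact h4.trans h7
      have h10 : 1 / θ * ‖x k t - metricProj (H k) (x k t)‖ ^ 2 ≤ 1 / θ * D' t := by
        gcongr
        exact h5.trans h7
      have h11 : A * D' t = 2 / γ * D' t + 1 / θ * D' t := by rw [hAθ, add_mul]
      rw [inner_smul_left] at h3
      simp only [conj_trivial] at h3
      linarith
  have h1 := hbd t ht k
  have h2 := hbd t ht l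
  have h3 := hbar t ht
  simp only [he, ho, hk, hl, if_true, if_false, one_mul, neg_mul] at h1 h2
  have h4 := real_inner_le_norm v (x l t - x k t)
  rw [inner_sub_right] at h4
  have h5 : ‖v‖ * ‖x l t - x k t‖ ≤ ‖x l t - x k t‖ := mul_le_of_le_one_left (norm_nonneg _) hv
  linarith

/-- If little is dissipated on an interval that contains a window with strongly connected union
graph, then the agents are close to each other at the beginning of the interval. -/
theorem exists_norm_sub_le (h : ClosedLoop f H dw M G σ x q) {γ : ℝ} (hγ : 0 < γ) :
    ∃ ε > 0, ∃ κ > 0, ∀ (s : ℝ) (p r : ℕ), 0 ≤ s → s ≤ σ p → p ≤ r → σ r - s ≤ 2 * M →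
      StronglyConnected (unionGraph G (σ p) (σ r)) → ∀ D D' : ℝ → ℝ,
      ContinuousOn D (Icc s (σ r)) →
      (∀ t ∈ Ico s (σ r), HasDerivWithinAt D (D' t) (Ici t) t) →
      (∀ t ∈ Ico s (σ r), dissipation H (G t) (fun j => x j t) ≤ D' t) →
      D (σ r) - D s ≤ ε →
      (∀ t ∈ Ico s (σ r), ∀ i,
        ‖(1 / Real.sqrt (q i t)) • gradient (f i) (x i t)‖ < κ) →
      ∀ i j, ‖x i s - x j s‖ ≤ γ * n := by
  have hM := h.M_pos
  have hdw := h.dw_pos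
  have hη := h.η_pos
  set A := 2 / γ + 48 * M / γ with hA
  have hApos : 0 < A := by positivity
  -- The first bound keeps the gap open. The second is half of what one edge across a gap of `γ / 2`
  -- dissipates during a dwell time.
  refine ⟨min (γ / (8 * A)) (η * (γ / 2) ^ 2 * dw / 2), by positivity, γ / (48 * M),
    by positivity, fun s p r hs hsp hpr hlen hconn D D' hD hD' hdiss hdrop hgrad i j => ?_⟩
  by_contra hcon
  push Not at hcon
  have hpos : 0 < ‖x i s - x j s‖ := lt_of_le_of_lt (by positivity) hcon
  set v : E m := ‖x i s - x j s‖⁻¹ • (x i s - x j s) with hv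
  have hvn : ‖v‖ = 1 := by
    rw [hv, norm_smul, norm_inv, norm_norm, inv_mul_cancel₀ hpos.ne']
  have hvi : inner ℝ v (x i s) - inner ℝ v (x j s) = ‖x i s - x j s‖ := by
    rw [← inner_sub_right, hv, real_inner_smul_left, real_inner_self_eq_norm_sq]
    field_simp
  -- The spread in direction `v` exceeds `γ * n`, so the `n` coordinates leave a gap longer than `γ`
  -- above one of them.
  obtain ⟨k, l, hkl, hgap⟩ : ∃ k l, inner ℝ v (x k s) < inner ℝ v (x l s) ∧
      ∀ l', inner ℝ v (x k s) < inner ℝ v (x l' s) →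
        inner ℝ v (x k s) + γ < inner ℝ v (x l' s) := by
    by_contra hc
    push Not at hc
    have := sub_le_of_no_gap (y := fun k => inner ℝ v (x k s)) hγ.le hc j i
    rw [Fintype.card_fin] at this
    linarith
  set S : Set (Fin n) := {l | inner ℝ v (x l s) ≤ inner ℝ v (x k s)} with hSdef
  have hmono : ∀ t₁ t₂, s ≤ t₁ → t₁ ≤ t₂ → t₂ ≤ σ r → D t₁ ≤ D t₂ := by
    intro t₁ t₂ h1 h2 h3
    have := mul_sub_le_of_le_deriv_right (c := 0) h2 (hD.mono (Icc_subset_Icc h1 h3))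
      (fun t ht => hD' t ⟨h1.trans ht.1, ht.2.trans_le h3⟩) fun t ht =>
        (dissipation_nonneg hη H _ _).trans (hdiss t ⟨h1.trans ht.1, ht.2.trans_le h3⟩)
    linarith
  have hpers : ∀ t ∈ Icc s (σ r), ∀ u ∈ S, ∀ w ∉ S, γ / 2 ≤ ‖x w t - x u t‖ := by
    intro t ht u hu w hw
    refine h.gap_persists (D := D) (D' := D') (c := inner ℝ v (x k s)) hs hγ hlen hD hD' hdiss
      (fun t ht => ?_) hgrad hvn.le (fun l hl => hl)
      (fun l hl => (hgap l (not_le.1 hl)).le) ht hu hw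
    have h1 := hmono t (σ r) ht.1 ht.2 le_rfl
    have h2 : D t - D s ≤ γ / (8 * A) := by linarith [hdrop.trans (min_le_left _ _)]
    calc A * (D t - D s) ≤ A * (γ / (8 * A)) := by gcongr
      _ = γ / 8 := by field_simp
  obtain ⟨u, hu, w, hw, t, ht, hadj⟩ := hconn.exists_adj_of_mem (S := S) (u := k) (w := l)
    (le_refl (inner ℝ v (x k s))) (not_le.2 hkl)
  -- The crossing edge exists at one time, hence throughout its switching interval. That interval
  -- lies inside the window because the window ends are switching times.
  obtain ⟨k', hk'⟩ := h.exists_mem_Ico_switching ((hs.trans hsp).trans ht.1)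
  have hk1 : p ≤ k' := by
    have := h.strictMono_switching.lt_iff_lt.1 (ht.1.trans_lt hk'.2)
    omega
  have hk2 : k' + 1 ≤ r := h.strictMono_switching.lt_iff_lt.1 (hk'.1.trans_lt ht.2)
  have hσ1 : s ≤ σ k' := hsp.trans (h.strictMono_switching.monotone hk1)
  have hσ2 : σ (k' + 1) ≤ σ r := h.strictMono_switching.monotone hk2
  have hstep := h.switching.dwell k'
  have hinc := mul_sub_le_of_le_deriv_right (c := η * (γ / 2) ^ 2) (by linarith)
    (hD.mono (Icc_subset_Icc hσ1 hσ2))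
    (fun t ht => hD' t ⟨hσ1.trans ht.1, ht.2.trans_le hσ2⟩) (fun t' ht' => by
      have hmem : t' ∈ Ico s (σ r) := ⟨hσ1.trans ht'.1, ht'.2.trans_le hσ2⟩
      have h1 : η ≤ (G t').a w u := by
        rw [h.switching.const k' t' ht', ← h.switching.const k' t hk']
        exact (G t).le_a w u hadj
      have h2 := mul_sq_le_dissipation hη H (G t') (fun j => x j t') w u
      have h3 := hpers t' (Ico_subset_Icc_self hmem) u hu w hw
      rw [norm_sub_rev] at h3
      refine le_trans ?_ (h2.trans (hdiss t' hmem))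
      have h4 := hη.le.trans h1
      gcongr)
  have h4 := hmono s (σ k') le_rfl hσ1 (by linarith)
  have h5 := hmono (σ (k' + 1)) (σ r) (by linarith) hσ2 le_rfl
  have h6 : η * (γ / 2) ^ 2 * dw ≤ η * (γ / 2) ^ 2 * (σ (k' + 1) - σ k') := by gcongr
  have h7 := hdrop.trans (min_le_right _ _)
  have h8 : 0 < η * (γ / 2) ^ 2 * dw := by positivity
  linarith

theorem isClosed_constraint (h : ClosedLoop f H dw M G σ x q) : IsClosed (⋂ i, H i) :=
  isClosed_iInter h.H_closed

theorem convex_constraint (h : ClosedLoop f H dw M G σ x q) : Convex ℝ (⋂ i, H i) :=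
  convex_iInter h.H_conv

theorem exists_subset_closedBall (h : ClosedLoop f H dw M G σ x q) :
    ∃ R > 0, (∀ t, 0 ≤ t → ∀ i, ‖x i t‖ ≤ R) ∧
      ∀ t, 0 ≤ t → (fun j => x j t) ∈ Metric.closedBall (0 : Fin n → E m) R := by
  obtain ⟨R, hR, hx⟩ := h.exists_state_bound
  refine ⟨R, hR, hx, fun t ht => ?_⟩
  rw [mem_closedBall_zero_iff, pi_norm_le_iff_of_nonneg hR.le]
  exact hx t ht

/-- Along the bounded trajectory, a continuous function tends to zero if a continuous function
with no other zeros does. -/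
theorem tendsto_zero_of_zeros (h : ClosedLoop f H dw M G σ x q) {φ u : (Fin n → E m) → ℝ}
    (hφ : Continuous φ) (hu : Continuous u) (hφ0 : ∀ X, 0 ≤ φ X) (hu0 : ∀ X, 0 ≤ u X)
    (hzero : ∀ X, φ X = 0 → u X = 0)
    (hlim : Tendsto (fun t => φ fun j => x j t) atTop (𝓝 0)) :
    Tendsto (fun t => u fun j => x j t) atTop (𝓝 0) := by
  obtain ⟨R, -, -, hx⟩ := h.exists_subset_closedBall
  rw [Metric.tendsto_nhds]
  intro δ hδ
  obtain ⟨ε, hε, hsmall⟩ := exists_pos_of_compact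
    (isCompact_closedBall (0 : Fin n → E m) R) hφ hu hφ0 (fun X hX => (hzero X hX).le) hδ
  filter_upwards [hlim.eventually_lt_const hε, eventually_ge_atTop 0] with t ht ht0
  rw [Real.dist_eq, sub_zero, abs_of_nonneg (hu0 _)]
  exact hsmall _ (hx t ht0) ht

theorem exists_abs_sub_le (h : ClosedLoop f H dw M G σ x q) {C : Set (E m)}
    (hb : Bornology.IsBounded C) :
    ∃ B > 0, ∀ z ∈ C, ∀ t, 0 ≤ t → ∀ i, |f i z - f i (x i t)| ≤ B := by
  obtain ⟨R, -, hx⟩ := h.exists_state_bound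
  obtain ⟨r, hr⟩ := isBounded_iff_forall_norm_le.1 hb
  have hcont : Continuous fun y => ∑ i, |f i y| :=
    continuous_finsetSum _ fun i _ => (h.f_diff i).continuous.abs
  obtain ⟨B, hB⟩ := (isCompact_closedBall (0 : E m) (max R r)).exists_bound_of_continuousOn
    hcont.continuousOn
  have hfB : ∀ i y, ‖y‖ ≤ max R r → |f i y| ≤ |B| := fun i y hy =>
    (Finset.single_le_sum (f := fun i => |f i y|) (fun _ _ => abs_nonneg _)
      (Finset.mem_univ i)).trans ((le_abs_self _).trans
        ((hB y (mem_closedBall_zero_iff.2 hy)).trans (le_abs_self B)))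
  refine ⟨2 * |B| + 1, by positivity, fun z hz t ht i => ?_⟩
  have h1 := hfB i z ((hr z hz).trans (le_max_right _ _))
  have h2 := hfB i (x i t) ((hx t ht i).trans (le_max_left _ _))
  linarith [abs_sub (f i z) (f i (x i t))]

theorem exists_deriv_sqSum_le (h : ClosedLoop f H dw M G σ x q) (r : ℝ) :
    ∃ C > 0, ∀ z ∈ ⋂ i, H i, ‖z‖ ≤ r → ∀ t, 0 ≤ t →
      2 * ∑ i, inner ℝ (x i t - z) (control f H (G t) (fun j => x j t) (fun j => q j t) i) ≤
        -dissipation H (G t) (fun j => x j t) + C * scale t := by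
  obtain ⟨c₁, hc₁, c₂, hc₂, hstep⟩ := h.exists_step_bounds
  obtain ⟨B, hB, hfB⟩ := h.exists_abs_sub_le (Metric.isBounded_closedBall (x := 0) (r := r))
  have hn : (0 : ℝ) < n := by exact_mod_cast h.n_pos
  refine ⟨2 * (n * (c₂ * B)), by positivity, fun z hz hzr t ht => ?_⟩
  refine (h.deriv_sqSum_le hz ht).trans ?_
  have hle : ∑ i, 1 / Real.sqrt (q i t) * (f i z - f i (x i t)) ≤
      ∑ _i : Fin n, c₂ * scale t * B := by
    refine Finset.sum_le_sum fun i _ => ?_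
    have h1 := (abs_le.1 (hfB z (mem_closedBall_zero_iff.2 hzr) t ht i)).2
    exact (mul_le_mul_of_nonneg_left h1 (by positivity)).trans
      (mul_le_mul_of_nonneg_right (hstep i t ht).2 hB.le)
  rw [Finset.sum_const, Finset.card_univ, Fintype.card_fin, nsmul_eq_mul] at hle
  linarith

theorem exists_projection_bound (h : ClosedLoop f H dw M G σ x q) {C : Set (E m)}
    (hne : C.Nonempty) (hC : IsClosed C) (hconv : Convex ℝ C) :
    ∃ r, ∀ t, 0 ≤ t → ‖metricProj C (average fun j => x j t)‖ ≤ r := by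
  obtain ⟨R, -, hx⟩ := h.exists_state_bound
  refine ⟨R + ‖metricProj C 0‖, fun t ht => ?_⟩
  have h1 := norm_metricProj_sub_le hne hC hconv (average fun j => x j t) 0
  rw [sub_zero] at h1
  have h2 := norm_average_le h.n_pos (hx t ht)
  have h3 := norm_add_le (metricProj C (average fun j => x j t) - metricProj C 0)
    (metricProj C 0)
  rw [sub_add_cancel] at h3
  linarith

/-- The squared distance to consensus in the constraint set decreases by the accumulated
dissipation `D`, up to a term that is controlled by the step sizes. -/
theorem exists_accumulated_dissipation (h : ClosedLoop f H dw M G σ x q) :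
    ∃ C > 0, ∀ s, 0 ≤ s → ∃ D D' : ℝ → ℝ, D s = 0 ∧ ContinuousOn D (Ici s) ∧
      (∀ t, s ≤ t → HasDerivWithinAt D (D' t) (Ici t) t) ∧
      (∀ t, s ≤ t → dissipation H (G t) (fun j => x j t) ≤ D' t) ∧
      ∀ t, s ≤ t → sqDist (⋂ i, H i) (fun j => x j t) ≤
        sqDist (⋂ i, H i) (fun j => x j s) + C * scale s * (t - s) - D t := by
  obtain ⟨r, hr⟩ := h.exists_projection_bound h.H_nonempty h.isClosed_constraint
    h.convex_constraint
  obtain ⟨C, hC, hder⟩ := h.exists_deriv_sqSum_le r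
  refine ⟨C, hC, fun s hs => ?_⟩
  set z := metricProj (⋂ i, H i) (average fun j => x j s) with hz
  have hzH : z ∈ ⋂ i, H i := (metricProj_spec h.H_nonempty h.isClosed_constraint _).1
  -- Instead of integrating the discontinuous dissipation, `D` is the slack in the Lyapunov
  -- inequality with `z` frozen at time `s`. Its right derivative dominates the dissipation because
  -- `scale` is decreasing.
  refine ⟨fun t => sqSum z (fun j => x j s) - sqSum z (fun j => x j t) + C * scale s * (t - s),
    fun t => -(2 * ∑ i, inner ℝ (x i t - z)
      (control f H (G t) (fun j => x j t) (fun j => q j t) i)) + C * scale s,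
    by ring, ?_, fun t ht => ?_, fun t ht => ?_, fun t ht => ?_⟩
  · have := (h.continuousOn_sqSum z).mono (Ici_subset_Ici.2 hs)
    fun_prop
  · have h1 := (h.hasDerivWithinAt_sqSum z (hs.trans ht)).const_sub (sqSum z fun j => x j s)
    have h2 := ((hasDerivWithinAt_id t (Ici t)).sub_const s).const_mul (C * scale s)
    rw [mul_one] at h2
    exact h1.add h2
  · have h1 := hder z hzH (hr s hs) t (hs.trans ht)
    have h2 := mul_le_mul_of_nonneg_left (scale_anti hs ht) hC.le
    linarith
  · have h1 := sqDist_le_sqSum h.n_pos h.isClosed_constraint hzH fun j => x j t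
    have h2 : sqDist (⋂ i, H i) (fun j => x j s) = sqSum z fun j => x j s := rfl
    rw [h2]
    linarith

theorem exists_windows (h : ClosedLoop f H dw M G σ x q) :
    ∃ p : ℕ → ℕ, StrictMono p ∧ p 0 = 0 ∧ ∀ j, σ (p (j + 1)) - σ (p j) ≤ M ∧
      StronglyConnected (unionGraph G (σ (p j)) (σ (p (j + 1)))) := by
  obtain ⟨τ, hτ, hτ0, hconn⟩ := h.connected
  choose p hp using hτ
  refine ⟨p, strictMono_nat_of_lt_succ fun j => ?_, ?_, fun j => ?_⟩
  · rw [← h.strictMono_switching.lt_iff_lt, hp, hp]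
    linarith [(hconn j).1]
  · apply h.strictMono_switching.injective
    rw [hp, hτ0, h.switching.zero]
  · rw [hp, hp]
    exact (hconn j).2

theorem exists_norm_step_gradient_le (h : ClosedLoop f H dw M G σ x q) :
    ∃ C > 0, ∀ t, 0 ≤ t → ∀ i,
      ‖(1 / Real.sqrt (q i t)) • gradient (f i) (x i t)‖ ≤ C * scale t := by
  obtain ⟨R, -, hx⟩ := h.exists_state_bound
  obtain ⟨c₁, hc₁, c₂, hc₂, hstep⟩ := h.exists_step_bounds
  choose L hL hgrad using fun i => exists_norm_gradient_le (h.f_conv i) (h.f_diff i) R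
  refine ⟨c₂ * (∑ i, L i + 1), mul_pos hc₂ (add_pos_of_nonneg_of_pos
    (Finset.sum_nonneg fun i _ => (hL i).le) one_pos), fun t ht i => ?_⟩
  have hg := scale_pos ht
  have h1 := Finset.single_le_sum (f := L) (fun i _ => (hL i).le) (Finset.mem_univ i)
  rw [norm_smul, Real.norm_eq_abs, abs_of_nonneg (by positivity)]
  calc 1 / Real.sqrt (q i t) * ‖gradient (f i) (x i t)‖
      ≤ c₂ * scale t * L i := by
        have := hstep i t ht
        gcongr
        · exact this.2
        · exact hgrad i _ (hx t ht i)
    _ ≤ c₂ * scale t * (∑ i, L i + 1) := by gcongr; linarith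
    _ = c₂ * (∑ i, L i + 1) * scale t := by ring

/-- States that are close to each other and to the constraint sets are close to the intersection
of these sets. -/
theorem exists_sqDist_constraint_lt (h : ClosedLoop f H dw M G σ x q) {δ : ℝ} (hδ : 0 < δ) :
    ∃ γ > 0, ∀ t, 0 ≤ t → (∀ i j, ‖x i t - x j t‖ ≤ γ) →
      (∀ i, ‖x i t - metricProj (H i) (x i t)‖ ≤ γ) →
      sqDist (⋂ i, H i) (fun j => x j t) < δ := by
  obtain ⟨R, -, -, hx⟩ := h.exists_subset_closedBall
  have hn := h.n_pos
  have hP : ∀ i, Continuous (metricProj (H i)) := fun i =>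
    continuous_metricProj (h.H_nonempty.mono (iInter_subset _ i)) (h.H_closed i) (h.H_conv i)
  set φ : (Fin n → E m) → ℝ := fun X => ∑ i, ∑ j, ‖X i - X j‖ + ∑ i, ‖X i - metricProj (H i) (X i)‖
    with hφ
  have hs1 : ∀ X : Fin n → E m, 0 ≤ ∑ i, ∑ j, ‖X i - X j‖ := fun X =>
    Finset.sum_nonneg fun _ _ => Finset.sum_nonneg fun _ _ => norm_nonneg _
  have hs2 : ∀ X : Fin n → E m, 0 ≤ ∑ i, ‖X i - metricProj (H i) (X i)‖ := fun X =>
    Finset.sum_nonneg fun _ _ => norm_nonneg _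
  have hzero : ∀ X, φ X = 0 → sqDist (⋂ i, H i) X ≤ 0 := by
    intro X hX
    have h1 : ∑ i, ∑ j, ‖X i - X j‖ = 0 := by linarith [hs1 X, hs2 X]
    have h2 : ∑ i, ‖X i - metricProj (H i) (X i)‖ = 0 := by linarith [hs1 X, hs2 X]
    rw [Finset.sum_eq_zero_iff_of_nonneg fun i _ => Finset.sum_nonneg fun _ _ => norm_nonneg _]
      at h1
    rw [Finset.sum_eq_zero_iff_of_nonneg fun i _ => norm_nonneg _] at h2
    have h3 : ∀ i, X i = X ⟨0, hn⟩ := fun i => by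
      have := h1 i (Finset.mem_univ i)
      rw [Finset.sum_eq_zero_iff_of_nonneg fun i _ => norm_nonneg _] at this
      exact sub_eq_zero.1 (norm_eq_zero.1 (this ⟨0, hn⟩ (Finset.mem_univ _)))
    have h4 : X ⟨0, hn⟩ ∈ ⋂ i, H i := mem_iInter.2 fun i => by
      have h5 := sub_eq_zero.1 (norm_eq_zero.1 (h2 i (Finset.mem_univ i)))
      rw [← h3 i, h5]
      exact (metricProj_spec (h.H_nonempty.mono (iInter_subset _ i)) (h.H_closed i) _).1
    refine (sqDist_le_sqSum hn h.isClosed_constraint h4 X).trans ?_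
    simp [sqSum, h3]
  obtain ⟨ε, hε, hsmall⟩ := exists_pos_of_compact
    (isCompact_closedBall (0 : Fin n → E m) R) (h := φ)
    (u := sqDist (⋂ i, H i)) (by
      have : ∀ i, Continuous fun X : Fin n → E m => metricProj (H i) (X i) := fun i =>
        (hP i).comp (continuous_apply i)
      fun_prop)
    (continuous_sqDist h.H_nonempty h.isClosed_constraint h.convex_constraint)
    (fun X => add_nonneg (hs1 X) (hs2 X)) hzero hδ
  have hn' : (0 : ℝ) < n := by exact_mod_cast hn
  refine ⟨ε / (n * n + n + 1), by positivity, fun t ht h1 h2 => hsmall _ (hx t ht) ?_⟩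
  have h3 : ∑ i, ∑ j, ‖x i t - x j t‖ ≤ ∑ _i : Fin n, ∑ _j : Fin n, ε / (n * n + n + 1) :=
    Finset.sum_le_sum fun i _ => Finset.sum_le_sum fun j _ => h1 i j
  have h4 : ∑ i, ‖x i t - metricProj (H i) (x i t)‖ ≤ ∑ _i : Fin n, ε / (n * n + n + 1) :=
    Finset.sum_le_sum fun i _ => h2 i
  simp only [Finset.sum_const, Finset.card_univ, Fintype.card_fin, nsmul_eq_mul] at h3 h4
  refine (add_le_add h3 h4).trans_lt ?_
  rw [mul_div_assoc', mul_div_assoc', ← add_div, div_lt_iff₀ (by positivity)]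
  nlinarith

/-- The agents reach consensus and converge to the constraint set. -/
theorem tendsto_sqDist_constraint (h : ClosedLoop f H dw M G σ x q) :
    Tendsto (fun t => sqDist (⋂ i, H i) fun j => x j t) atTop (𝓝 0) := by
  obtain ⟨C, hC, hacc⟩ := h.exists_accumulated_dissipation
  obtain ⟨C', hC', hgrad⟩ := h.exists_norm_step_gradient_le
  obtain ⟨p, hp, hp0, hwin⟩ := h.exists_windows
  have hn : (0 : ℝ) < n := by exact_mod_cast h.n_pos
  have hM := h.M_pos
  have hdw := h.dw_pos
  have hη := h.η_pos
  set U : ℝ → ℝ := fun t => sqDist (⋂ i, H i) fun j => x j t with hU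
  have hU0 : ∀ t, 0 ≤ U t := fun t => sqDist_nonneg _ _
  have hgrowth : ∀ s t, 0 ≤ s → s ≤ t → t - s ≤ 2 * M → U t ≤ U s + C * scale s * (2 * M) := by
    intro s t hs hst hts
    obtain ⟨D, D', hD0, hDc, hD', hdiss, hle⟩ := hacc s hs
    have h1 := mul_sub_le_of_le_deriv_right (c := 0) hst (hDc.mono Icc_subset_Ici_self)
      (fun t ht => hD' t ht.1) fun t ht => (dissipation_nonneg hη H _ _).trans (hdiss t ht.1)
    have h2 := hle t hst
    have h3 : C * scale s * (t - s) ≤ C * scale s * (2 * M) := by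
      have := scale_pos hs
      gcongr
    simp only [hU]
    linarith
  -- Two windows per step: the first supplies a time `s` of small dissipation, the second is then a
  -- complete connected window after `s`.
  set ρ : ℕ → ℝ := fun k => σ (p (2 * k)) with hρ
  have hσmono := h.strictMono_switching
  have hρ0 : ∀ k, 0 ≤ ρ k := fun k => h.switching_nonneg _
  have hρlen : ∀ k, ρ (k + 1) - ρ k ≤ 2 * M := fun k => by
    have h1 := (hwin (2 * k)).1
    have h2 := (hwin (2 * k + 1)).1
    simp only [hρ, show 2 * (k + 1) = 2 * k + 1 + 1 by ring]
    linarith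
  have hρmono : StrictMono ρ := fun a b hab => hσmono (hp (by omega))
  have hρlim : Tendsto ρ atTop atTop :=
    h.tendsto_switching.comp (hp.tendsto_atTop.comp
      (tendsto_id.const_mul_atTop' (by norm_num)))
  have hscale : Tendsto (fun k => scale (ρ k)) atTop (𝓝 0) := tendsto_scale.comp hρlim
  rw [Metric.tendsto_nhds]
  intro δ₀ hδ₀
  -- Values at the times `ρ k` are eventually at most `2 * δ`, and the growth in between is at most
  -- `δ`.
  set δ := δ₀ / 4 with hδ
  have hδpos : 0 < δ := by positivity
  obtain ⟨γ, hγ, hclose⟩ := h.exists_sqDist_constraint_lt hδpos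
  obtain ⟨ε₁, hε₁, κ, hκ, hwindow⟩ := h.exists_norm_sub_le (γ := γ / n) (by positivity)
  -- By the second bound, dissipation of at least `γ ^ 2` throughout the first window, whose length
  -- is at least `dw`, would exceed `ε`.
  set ε := min ε₁ (γ ^ 2 * dw / 2) with hε
  have hεpos : 0 < ε := by positivity
  have hev1 : ∀ᶠ k in atTop, C * scale (ρ k) * (2 * M) < min δ (ε / 2) := by
    have : Tendsto (fun k => C * scale (ρ k) * (2 * M)) atTop (𝓝 0) := by
      simpa using (hscale.const_mul C).mul_const (2 * M)
    exact this.eventually_lt_const (by positivity)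
  have hev2 : ∀ᶠ k in atTop, C' * scale (ρ k) < κ := by
    have : Tendsto (fun k => C' * scale (ρ k)) atTop (𝓝 0) := by
      simpa using hscale.const_mul C'
    exact this.eventually_lt_const hκ
  have hdrop : ∀ᶠ k in atTop, U (ρ (k + 1)) ≤ U (ρ k) - ε / 2 ∨ U (ρ (k + 1)) ≤ 2 * δ := by
    filter_upwards [hev1, hev2] with k hk1 hk2
    have hk1' := hk1.le.trans (min_le_left _ _)
    have hk1'' := hk1.le.trans (min_le_right _ _)
    obtain ⟨D, D', hD0, hDc, hD', hdiss, hle⟩ := hacc (ρ k) (hρ0 k)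
    have hkk : ρ k ≤ ρ (k + 1) := (hρmono k.lt_succ_self).le
    have hsk := scale_pos (hρ0 k)
    rcases lt_or_ge ε (D (ρ (k + 1))) with hlt | hge
    · left
      have h1 := hle _ hkk
      have h2 : C * scale (ρ k) * (ρ (k + 1) - ρ k) ≤ C * scale (ρ k) * (2 * M) := by
        have := hρlen k
        gcongr
      simp only [hU]
      linarith
    · right
      set b := σ (p (2 * k + 1)) with hb
      have hkb : ρ k < b := hσmono (hp (by omega))
      have hbk : b < ρ (k + 1) := hσmono (hp (by omega))
      have hmono : ∀ t₁ t₂, ρ k ≤ t₁ → t₁ ≤ t₂ → D t₁ ≤ D t₂ := by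
        intro t₁ t₂ h1 h2
        have := mul_sub_le_of_le_deriv_right (c := 0) h2
          (hDc.mono fun t ht => h1.trans ht.1) (fun t ht => hD' t (h1.trans ht.1))
          fun t ht => (dissipation_nonneg hη H _ _).trans (hdiss t (h1.trans ht.1))
        linarith
      have hblen : dw ≤ b - ρ k := by
        have h1 := h.switching.dwell (p (2 * k))
        have h2 : σ (p (2 * k) + 1) ≤ b := hσmono.monotone (hp (by omega : 2 * k < 2 * k + 1))
        simp only [hρ]
        linarith
      obtain ⟨s, hs, hsD⟩ : ∃ s ∈ Ico (ρ k) b, dissipation H (G s) (fun j => x j s) < γ ^ 2 := by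
        by_contra hc
        push Not at hc
        have h1 := mul_sub_le_of_le_deriv_right hkb.le (hDc.mono Icc_subset_Ici_self)
          (fun t ht => hD' t ht.1) fun t ht => (hc t ht).trans (hdiss t ht.1)
        have h2 := hmono b _ hkb.le hbk.le
        have h3 : γ ^ 2 * dw ≤ γ ^ 2 * (b - ρ k) := by gcongr
        have h4 := hge.trans (min_le_right _ _)
        have h5 : 0 < γ ^ 2 * dw := by positivity
        linarith
      have hs0 : 0 ≤ s := (hρ0 k).trans hs.1
      have hUs : U s < δ := by
        refine hclose s hs0 (fun i j => ?_) fun i => ?_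
        · have h1 := hwindow s (p (2 * k + 1)) (p (2 * k + 1 + 1)) hs0 hs.2.le
            (hp.monotone (by omega)) (by
              have := hρlen k
              have := hs.1
              simp only [hρ, show 2 * (k + 1) = 2 * k + 1 + 1 by ring] at *
              linarith) (hwin (2 * k + 1)).2 D D'
            (hDc.mono fun t ht => hs.1.trans ht.1) (fun t ht => hD' t (hs.1.trans ht.1))
            (fun t ht => hdiss t (hs.1.trans ht.1)) (by
              have h1 := hmono (ρ k) s le_rfl hs.1
              have h2 : D (σ (p (2 * k + 1 + 1))) ≤ ε := hge
              linarith [h2.trans (min_le_left _ _)])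
            (fun t ht i => (hgrad t (hs0.trans ht.1) i).trans_lt
              ((mul_le_mul_of_nonneg_left (scale_anti (hρ0 k) (hs.1.trans ht.1)) hC'.le).trans_lt
                hk2)) i j
          rwa [div_mul_cancel₀ _ hn.ne'] at h1
        · have h1 := sq_norm_sub_metricProj_le_dissipation hη H (G s) (fun j => x j s) i
          exact le_of_sq_le_sq (h1.trans hsD.le) hγ.le
      have h1 := hgrowth s (ρ (k + 1)) hs0 (hs.2.le.trans hbk.le) (by linarith [hρlen k, hs.1])
      have h2 : C * scale s * (2 * M) ≤ C * scale (ρ k) * (2 * M) := by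
        have := scale_anti (hρ0 k) hs.1
        gcongr
      linarith
  have hfin := eventually_le_of_drop (u := fun k => U (ρ k)) (by positivity)
    (fun k => hU0 _) hdrop
  obtain ⟨K, hK⟩ := eventually_atTop.1 (hfin.and hev1)
  filter_upwards [eventually_ge_atTop (ρ K)] with t ht
  rw [Real.dist_eq, sub_zero, abs_of_nonneg (hU0 t)]
  have hρ00 : ρ 0 = 0 := by simp only [hρ, mul_zero, hp0, h.switching.zero]
  obtain ⟨k, hk⟩ := exists_mem_Ico_of_tendsto (hρ00.trans_le ((hρ0 K).trans ht)) hρlim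
  have hKk : K ≤ k := by
    have := hρmono.lt_iff_lt.1 (ht.trans_lt hk.2)
    omega
  obtain ⟨h1, h2⟩ := hK k hKk
  have h3 := hgrowth (ρ k) t (hρ0 k) hk.1 (by linarith [hρlen k, hk.2])
  have h4 := h2.le.trans (min_le_left _ _)
  linarith

/-! ### The optimal set -/

theorem continuous_objective (h : ClosedLoop f H dw M G σ x q) :
    Continuous fun y => ∑ i, f i y :=
  continuous_finsetSum _ fun i _ => (h.f_diff i).continuous

theorem isBounded_sublevel (h : ClosedLoop f H dw M G σ x q) (c : ℝ) :
    Bornology.IsBounded {y | ∑ i, f i y ≤ c} := by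
  obtain ⟨α, hα, β, hβ⟩ := h.exists_uniform_growth
  have hn : (0 : ℝ) < n := by exact_mod_cast h.n_pos
  refine isBounded_iff_forall_norm_le.2 ⟨(c / n + β) / α, fun y hy => ?_⟩
  have h1 : ∑ _i : Fin n, (α * ‖y‖ - β) ≤ ∑ i, f i y := Finset.sum_le_sum fun i _ => hβ i y
  rw [Finset.sum_const, Finset.card_univ, Fintype.card_fin, nsmul_eq_mul] at h1
  have h2 : n * (α * ‖y‖ - β) ≤ c := h1.trans hy
  rw [le_div_iff₀ hα, ← sub_le_iff_le_add, le_div_iff₀ hn]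
  linarith

theorem optimalSet_nonempty (h : ClosedLoop f H dw M G σ x q) : (optimalSet f H).Nonempty := by
  obtain ⟨z, hz⟩ := h.H_nonempty
  have hcl : IsClosed ((⋂ i, H i) ∩ {y | ∑ i, f i y ≤ ∑ i, f i z}) :=
    h.isClosed_constraint.inter (isClosed_le h.continuous_objective continuous_const)
  have hK := Metric.isCompact_of_isClosed_isBounded hcl
    ((h.isBounded_sublevel _).subset inter_subset_right)
  obtain ⟨s, hs, hmin⟩ := hK.exists_isMinOn ⟨z, hz, le_refl (∑ i, f i z)⟩
    h.continuous_objective.continuousOn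
  refine ⟨s, hs.1, fun y hy => ?_⟩
  rcases le_total (∑ i, f i y) (∑ i, f i z) with hle | hge
  · exact hmin ⟨hy, hle⟩
  · exact hs.2.trans hge

theorem optimalSet_isBounded (h : ClosedLoop f H dw M G σ x q) :
    Bornology.IsBounded (optimalSet f H) := by
  obtain ⟨z, hz⟩ := h.H_nonempty
  exact (h.isBounded_sublevel (∑ i, f i z)).subset fun s hs => hs.2 z hz

theorem optimalSet_isClosed (h : ClosedLoop f H dw M G σ x q) : IsClosed (optimalSet f H) := by
  have : optimalSet f H = (⋂ i, H i) ∩ ⋂ y ∈ ⋂ i, H i, {s | ∑ i, f i s ≤ ∑ i, f i y} := by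
    ext s
    simp only [optimalSet, mem_inter_iff, mem_iInter, mem_ofPred_eq]
  rw [this]
  exact h.isClosed_constraint.inter (isClosed_biInter fun y _ =>
    isClosed_le h.continuous_objective continuous_const)

theorem optimalSet_convex (h : ClosedLoop f H dw M G σ x q) : Convex ℝ (optimalSet f H) := by
  intro s hs t ht a b ha hb hab
  refine ⟨h.convex_constraint hs.1 ht.1 ha hb hab, fun y hy => ?_⟩
  have h1 : ∑ i, f i (a • s + b • t) ≤ ∑ i, (a * f i s + b * f i t) :=
    Finset.sum_le_sum fun i _ => (h.f_conv i).2 (mem_univ s) (mem_univ t) ha hb hab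
  rw [Finset.sum_add_distrib, ← Finset.mul_sum, ← Finset.mul_sum] at h1
  have h2 := mul_le_mul_of_nonneg_left (hs.2 y hy) ha
  have h3 := mul_le_mul_of_nonneg_left (ht.2 y hy) hb
  have h4 : a * ∑ i, f i y + b * ∑ i, f i y = ∑ i, f i y := by rw [← add_mul, hab, one_mul]
  linarith

/-! ### The step sizes become equal -/

/-- The rates depend only on the states, which coincide at every zero of `sqDist`; boundedness
supplies the uniformity. -/
theorem tendsto_gain_rate_sub (h : ClosedLoop f H dw M G σ x q) (i j : Fin n) :
    Tendsto (fun t => |Real.arctan (Real.exp ‖x i t‖) - Real.arctan (Real.exp ‖x j t‖)|)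
      atTop (𝓝 0) := by
  refine h.tendsto_zero_of_zeros (φ := sqDist (⋂ i, H i))
    (u := fun X => |Real.arctan (Real.exp ‖X i‖) - Real.arctan (Real.exp ‖X j‖)|)
    (continuous_sqDist h.H_nonempty h.isClosed_constraint h.convex_constraint) ?_
    (fun X => sqDist_nonneg _ _) (fun X => abs_nonneg _) (fun X hX => ?_)
    h.tendsto_sqDist_constraint
  · have : ∀ k : Fin n, Continuous fun X : Fin n → E m => Real.arctan (Real.exp ‖X k‖) :=
      fun k => Real.continuous_arctan.comp (by fun_prop)
    exact ((this i).sub (this j)).abs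
  · rw [eq_of_sqSum_eq_zero hX i, eq_of_sqSum_eq_zero hX j, sub_self, abs_zero]

/-- After a time `T` the rates differ by less than `ε / 2`; the discrepancy accumulated until `T` is
absorbed by the other half of `ε * t` for large `t`. -/
theorem eventually_gain_sub_le (h : ClosedLoop f H dw M G σ x q) (i j : Fin n) {ε : ℝ}
    (hε : 0 < ε) : ∀ᶠ t in atTop, |q i t - q j t| ≤ ε * (1 + t) := by
  obtain ⟨T, hT⟩ := eventually_atTop.1
    (((h.tendsto_gain_rate_sub i j).eventually_lt_const (half_pos hε)).and
      (eventually_ge_atTop 0))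
  have hT0 := (hT T le_rfl).2
  filter_upwards [eventually_ge_atTop T, eventually_ge_atTop (2 * |q i T - q j T| / ε)]
    with t ht ht'
  have h1 := norm_image_sub_le_of_norm_deriv_right_le_segment (f := fun t => q i t - q j t)
    (f' := fun t => Real.arctan (Real.exp ‖x i t‖) - Real.arctan (Real.exp ‖x j t‖))
    (a := T) (b := t) (C := ε / 2)
    (((h.continuousOn_gain i).sub (h.continuousOn_gain j)).mono fun s hs => hT0.trans hs.1)
    (fun s hs => (h.hasDerivWithinAt_gain i (hT0.trans hs.1)).sub
      (h.hasDerivWithinAt_gain j (hT0.trans hs.1)))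
    (fun s hs => (hT s hs.1).1.le) t (right_mem_Icc.2 ht)
  rw [Real.norm_eq_abs] at h1
  rw [div_le_iff₀ hε] at ht'
  have h2 := abs_add_le (q i t - q j t - (q i T - q j T)) (q i T - q j T)
  rw [sub_add_cancel] at h2
  have h3 : 0 ≤ ε * T := by positivity
  linarith

/-- The gains exceed `c * (1 + t)`, so the Lipschitz constant of the inverse square root is of order
`(1 + t) ^ (-3/2)`, against a difference of gains of order `ε * (1 + t)`. -/
theorem eventually_step_sub_le (h : ClosedLoop f H dw M G σ x q) (i j : Fin n) {ε : ℝ}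
    (hε : 0 < ε) : ∀ᶠ t in atTop,
      |1 / Real.sqrt (q i t) - 1 / Real.sqrt (q j t)| ≤ ε * scale t := by
  obtain ⟨c, hc, _, -, hb⟩ := h.exists_gain_bounds
  have hcs : 0 < Real.sqrt c := Real.sqrt_pos.2 hc
  filter_upwards [h.eventually_gain_sub_le i j (show 0 < ε * (c * Real.sqrt c) by positivity),
    eventually_ge_atTop 0] with t ht ht0
  have h1 : 0 < 1 + t := by linarith
  refine (abs_one_div_sqrt_sub_le (mul_pos hc h1) (hb i t ht0).1 (hb j t ht0).1).trans ?_
  rw [div_le_iff₀ (by positivity), scale, Real.sqrt_mul hc.le]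
  refine ht.trans_eq ?_
  field_simp

/-! ### Convergence to the optimal set -/

/-- Away from the optimal set, the squared distance to the nearest optimal point decreases at the
rate of the step sizes. -/
theorem exists_descent_rate (h : ClosedLoop f H dw M G σ x q) {δ : ℝ} (hδ : 0 < δ) :
    ∃ c > 0, ∀ᶠ t in atTop, δ ≤ sqDist (optimalSet f H) (fun j => x j t) →
      ∀ z ∈ optimalSet f H, 2 * ∑ i, inner ℝ (x i t - z)
        (control f H (G t) (fun j => x j t) (fun j => q j t) i) ≤ -(c * scale t) := by
  obtain ⟨R, -, -, hx⟩ := h.exists_subset_closedBall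
  obtain ⟨c₁, hc₁, c₂, hc₂, hstep⟩ := h.exists_step_bounds
  obtain ⟨B, hB, hfB⟩ := h.exists_abs_sub_le h.optimalSet_isBounded
  obtain ⟨z₀, hz₀⟩ := h.optimalSet_nonempty
  have hn : (0 : ℝ) < n := by exact_mod_cast h.n_pos
  -- This vanishes only when all agents sit at one feasible point with optimal value. Its consensus
  -- part tends to zero, so away from the optimal set the excess of the objective must be at least
  -- `ε / 2`.
  set φ : (Fin n → E m) → ℝ := fun X =>
    sqDist (⋂ i, H i) X + max (∑ i, f i (X i) - ∑ i, f i z₀) 0 with hφ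
  have hfc : ∀ i, Continuous fun X : Fin n → E m => f i (X i) := fun i =>
    (h.f_diff i).continuous.comp (continuous_apply i)
  have hcφ : Continuous φ := by
    have := continuous_sqDist (n := n) h.H_nonempty h.isClosed_constraint h.convex_constraint
    exact this.add (((continuous_finsetSum _ fun i _ => hfc i).sub continuous_const).max
      continuous_const)
  obtain ⟨ε, hε, hsmall⟩ := exists_pos_of_compact
    (isCompact_closedBall (0 : Fin n → E m) R) hcφ
    (continuous_sqDist h.optimalSet_nonempty h.optimalSet_isClosed h.optimalSet_convex)
    (fun X => add_nonneg (sqDist_nonneg _ _) (le_max_right _ _)) (fun X hX => by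
      have h1 := sqDist_nonneg (⋂ i, H i) X
      have h2 := le_max_right (∑ i, f i (X i) - ∑ i, f i z₀) 0
      have h3 := le_max_left (∑ i, f i (X i) - ∑ i, f i z₀) 0
      have h4 : sqDist (⋂ i, H i) X = 0 := by simp only [hφ] at hX; linarith
      have h5 : ∑ i, f i (X i) ≤ ∑ i, f i z₀ := by simp only [hφ] at hX; linarith
      have h6 := eq_of_sqSum_eq_zero h4
      set p := metricProj (⋂ i, H i) (average X)
      have hp : p ∈ ⋂ i, H i := (metricProj_spec h.H_nonempty h.isClosed_constraint _).1
      simp only [h6] at h5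
      refine (sqDist_le_sqSum h.n_pos h.optimalSet_isClosed
        (⟨hp, fun y hy => h5.trans (hz₀.2 y hy)⟩ : p ∈ optimalSet f H) X).trans_eq h4) hδ
  refine ⟨c₁ * ε / 2, by positivity, ?_⟩
  have hall : ∀ᶠ t in atTop, ∀ i, |1 / Real.sqrt (q i t) - 1 / Real.sqrt (q ⟨0, h.n_pos⟩ t)| ≤
      c₁ * ε / (4 * n * B) * scale t :=
    eventually_all.2 fun i => h.eventually_step_sub_le i _ (by positivity)
  filter_upwards [hall, h.tendsto_sqDist_constraint.eventually_lt_const (half_pos hε),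
    eventually_ge_atTop 0] with t ht htU ht0 hV z hz
  have hg := scale_pos ht0
  have hF : ∑ i, f i z = ∑ i, f i z₀ := le_antisymm (hz.2 _ hz₀.1) (hz₀.2 _ hz.1)
  have hgap : ∑ i, f i z - ∑ i, f i (x i t) ≤ -(ε / 2) := by
    by_contra hc
    push Not at hc
    refine absurd (hsmall _ (hx t ht0) ?_) (not_lt.2 hV)
    have : max (∑ i, f i (x i t) - ∑ i, f i z₀) 0 < ε / 2 := max_lt (by linarith) (half_pos hε)
    simp only [hφ]
    linarith
  have h1 := h.deriv_sqSum_le hz.1 ht0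
  have h2 := dissipation_nonneg h.η_pos H (G t) (fun j => x j t)
  set s₀ := 1 / Real.sqrt (q ⟨0, h.n_pos⟩ t) with hs₀
  -- With one common step size only the team objective matters. The error from unequal steps is at
  -- most `c₁ * scale t * (ε / 4)`, half of the guaranteed decrease.
  have h3 : ∑ i, 1 / Real.sqrt (q i t) * (f i z - f i (x i t)) =
      s₀ * (∑ i, f i z - ∑ i, f i (x i t)) +
        ∑ i, (1 / Real.sqrt (q i t) - s₀) * (f i z - f i (x i t)) := by
    rw [← Finset.sum_sub_distrib, Finset.mul_sum, ← Finset.sum_add_distrib]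
    exact Finset.sum_congr rfl fun i _ => by ring
  have h4 : ∑ i, (1 / Real.sqrt (q i t) - s₀) * (f i z - f i (x i t)) ≤
      ∑ _i : Fin n, c₁ * ε / (4 * n * B) * scale t * B := by
    refine Finset.sum_le_sum fun i _ => (le_abs_self _).trans ?_
    rw [abs_mul]
    exact mul_le_mul (ht i) (hfB z hz t ht0 i) (abs_nonneg _) (by positivity)
  have h5 : ∑ _i : Fin n, c₁ * ε / (4 * n * B) * scale t * B = c₁ * scale t * (ε / 4) := by
    rw [Finset.sum_const, Finset.card_univ, Fintype.card_fin, nsmul_eq_mul]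
    field_simp
  have h6 : s₀ * (∑ i, f i z - ∑ i, f i (x i t)) ≤ c₁ * scale t * -(ε / 2) := by
    have := (hstep ⟨0, h.n_pos⟩ t ht0).1
    have h7 : 0 ≤ s₀ := by positivity
    nlinarith [mul_le_mul_of_nonneg_left hgap h7]
  nlinarith

/-- The upper right Dini derivative of the squared distance to `C` is at most the derivative of the
squared distance to the nearest point of `C`. -/
theorem frequently_slope_sqDist_lt (h : ClosedLoop f H dw M G σ x q) {C : Set (E m)}
    (hne : C.Nonempty) (hC : IsClosed C) {t r : ℝ} (ht : 0 ≤ t)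
    (hr : 2 * ∑ i, inner ℝ (x i t - metricProj C (average fun j => x j t))
      (control f H (G t) (fun j => x j t) (fun j => q j t) i) < r) :
    ∃ᶠ s in 𝓝[>] t, slope (fun t => sqDist C fun j => x j t) t s < r := by
  have h1 := (hasDerivWithinAt_iff_tendsto_slope' self_notMem_Ioi).1
    (h.hasDerivWithinAt_sqSum (metricProj C (average fun j => x j t)) ht).Ioi_of_Ici
  refine Eventually.frequently ?_
  filter_upwards [h1.eventually_lt_const hr, self_mem_nhdsWithin] with s hs hts
  refine lt_of_le_of_lt ?_ hs
  have h2 : 0 < s - t := sub_pos.2 hts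
  rw [slope_def_field, slope_def_field]
  have h3 := sqDist_le_sqSum h.n_pos hC (metricProj_spec hne hC (average fun j => x j t)).1
    fun j => x j s
  gcongr
  exact le_rfl

/-- The agents converge to the optimal set. -/
theorem tendsto_sqDist_optimalSet (h : ClosedLoop f H dw M G σ x q) :
    Tendsto (fun t => sqDist (optimalSet f H) fun j => x j t) atTop (𝓝 0) := by
  set O := optimalSet f H with hO
  set V : ℝ → ℝ := fun t => sqDist O fun j => x j t with hV
  set V' : ℝ → ℝ := fun t => 2 * ∑ i, inner ℝ (x i t - metricProj O (average fun j => x j t))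
      (control f H (G t) (fun j => x j t) (fun j => q j t) i) with hV'
  have hVc : ContinuousOn V (Ici 0) :=
    (continuous_sqDist h.optimalSet_nonempty h.optimalSet_isClosed
      h.optimalSet_convex).comp_continuousOn h.continuousOn_state
  have hV0 : ∀ t, 0 ≤ V t := fun t => sqDist_nonneg _ _
  have hslope : ∀ t, 0 ≤ t → ∀ r, V' t < r → ∃ᶠ s in 𝓝[>] t, slope V t s < r :=
    fun t ht r hr => h.frequently_slope_sqDist_lt h.optimalSet_nonempty h.optimalSet_isClosed ht hr
  rw [Metric.tendsto_nhds]
  intro δ₀ hδ₀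
  set δ := δ₀ / 2 with hδ
  have hδpos : 0 < δ := by positivity
  obtain ⟨c, hc, hrate⟩ := h.exists_descent_rate hδpos
  obtain ⟨T, hT⟩ := eventually_atTop.1 (hrate.and (eventually_ge_atTop 0))
  have hT0 : 0 ≤ T := (hT T le_rfl).2
  have hdesc : ∀ t, T ≤ t → δ ≤ V t → V' t ≤ -(c * scale t) := fun t ht hVt =>
    (hT t ht).1 hVt _ (metricProj_spec h.optimalSet_nonempty h.optimalSet_isClosed _).1
  obtain ⟨s, hTs, hVs⟩ : ∃ s ≥ T, V s ≤ δ := by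
    by_contra hcon
    push Not at hcon
    -- This barrier descends at half the guaranteed rate, which makes the comparison strict, and
    -- still tends to `-∞`, contradicting `V ≥ 0`.
    set B : ℝ → ℝ := fun t => V T - c * (Real.sqrt (1 + t) - Real.sqrt (1 + T)) with hB
    have hle : ∀ t, T ≤ t → V t ≤ B t := by
      intro t ht
      refine image_le_of_liminf_slope_right_lt_deriv_boundary' (f' := V')
        (B' := fun t => -(c * (1 / (2 * Real.sqrt (1 + t)))))
        (hVc.mono fun s hs => hT0.trans hs.1) (fun s hs => hslope s (hT0.trans hs.1))
        (by simp [hB]) (by fun_prop) (fun s hs => ?_) (fun s hs _ => ?_) (right_mem_Icc.2 ht)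
      · have h1 : (1 : ℝ) + s ≠ 0 := by linarith [hs.1]
        have h2 := (((hasDerivWithinAt_id s (Ici s)).const_add 1).sqrt h1).sub_const
          (Real.sqrt (1 + T))
        exact (h2.const_mul c).const_sub (V T)
      · refine (hdesc s hs.1 (hcon s hs.1).le).trans_lt (neg_lt_neg ?_)
        have h1 : 0 < 1 + s := by linarith [hs.1]
        have h2 : 0 < Real.sqrt (1 + s) := Real.sqrt_pos.2 h1
        rw [scale]
        gcongr
        linarith
    have hlim : Tendsto (fun t => c * (Real.sqrt (1 + t) - Real.sqrt (1 + T))) atTop atTop :=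
      (tendsto_atTop_add_const_right _ _ tendsto_sqrt_one_add).const_mul_atTop hc
    obtain ⟨t, ht, ht'⟩ := ((hlim.eventually_gt_atTop (V T)).and (eventually_ge_atTop T)).exists
    have h1 := hle t ht'
    have h2 := hV0 t
    simp only [hB] at h1
    linarith
  filter_upwards [eventually_ge_atTop s] with t ht
  rw [Real.dist_eq, sub_zero, abs_of_nonneg (hV0 t)]
  have hs0 : 0 ≤ s := hT0.trans hTs
  -- The level `δ` acts as a constant barrier: on contact the descent rate is strictly negative.
  have h1 : V t ≤ δ := image_le_of_liminf_slope_right_lt_deriv_boundary' (f' := V')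
    (B := fun _ => δ) (B' := fun _ => 0)
    (hVc.mono fun r hr => hs0.trans hr.1) (fun r hr => hslope r (hs0.trans hr.1)) hVs
    continuousOn_const (fun r _ => hasDerivWithinAt_const _ _ _) (fun r hr hreq => by
      have h2 := hdesc r (hTs.trans hr.1) hreq.ge
      have h3 := mul_pos hc (scale_pos (hs0.trans hr.1))
      linarith) (right_mem_Icc.2 ht)
  linarith

/-! ### Limits read off from the zeros of the Lyapunov function -/

theorem tendsto_sub_average (h : ClosedLoop f H dw M G σ x q) (i : Fin n) :
    Tendsto (fun t => x i t - average fun j => x j t) atTop (𝓝 0) := by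
  rw [tendsto_zero_iff_norm_tendsto_zero]
  refine h.tendsto_zero_of_zeros (φ := sqDist (optimalSet f H))
    (u := fun X => ‖X i - average X‖)
    (continuous_sqDist h.optimalSet_nonempty h.optimalSet_isClosed h.optimalSet_convex)
    (((continuous_apply i).sub continuous_average).norm) (fun X => sqDist_nonneg _ _)
    (fun X => norm_nonneg _) (fun X hX => ?_) h.tendsto_sqDist_optimalSet
  have h1 := sqSum_average_le_sqDist h.n_pos (optimalSet f H) X
  rw [hX] at h1
  rw [eq_of_sqSum_eq_zero (le_antisymm h1 (sqSum_nonneg _ _)) i, sub_self, norm_zero]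

theorem tendsto_infDist_optimalSet (h : ClosedLoop f H dw M G σ x q) (i : Fin n) :
    Tendsto (fun t => Metric.infDist (x i t) (optimalSet f H)) atTop (𝓝 0) := by
  refine h.tendsto_zero_of_zeros (φ := sqDist (optimalSet f H))
    (u := fun X => Metric.infDist (X i) (optimalSet f H))
    (continuous_sqDist h.optimalSet_nonempty h.optimalSet_isClosed h.optimalSet_convex)
    ((Metric.continuous_infDist_pt _).comp (continuous_apply i)) (fun X => sqDist_nonneg _ _)
    (fun X => Metric.infDist_nonneg) (fun X hX => ?_) h.tendsto_sqDist_optimalSet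
  rw [eq_of_sqSum_eq_zero hX i]
  exact Metric.infDist_zero_of_mem
    (metricProj_spec h.optimalSet_nonempty h.optimalSet_isClosed _).1

theorem tendsto_objective (h : ClosedLoop f H dw M G σ x q) {z : E m} (hz : z ∈ optimalSet f H) :
    Tendsto (fun t => ∑ i, f i (x i t)) atTop (𝓝 (∑ i, f i z)) := by
  rw [tendsto_iff_norm_sub_tendsto_zero]
  refine h.tendsto_zero_of_zeros (φ := sqDist (optimalSet f H))
    (u := fun X => ‖∑ i, f i (X i) - ∑ i, f i z‖)
    (continuous_sqDist h.optimalSet_nonempty h.optimalSet_isClosed h.optimalSet_convex)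
    (((continuous_finsetSum _ fun i _ => (h.f_diff i).continuous.comp
      (continuous_apply i)).sub continuous_const).norm) (fun X => sqDist_nonneg _ _)
    (fun X => norm_nonneg _) (fun X hX => ?_) h.tendsto_sqDist_optimalSet
  have hp := (metricProj_spec h.optimalSet_nonempty h.optimalSet_isClosed (average X)).1
  simp only [eq_of_sqSum_eq_zero hX]
  rw [le_antisymm (hp.2 _ hz.1) (hz.2 _ hp.1), sub_self, norm_zero]

end ClosedLoop

end DistOpt

theorem mainTheorem2 {n m : ℕ} (hn : 0 < n)
    (f : Fin n → DistOpt.E m → ℝ) (H : Fin n → Set (DistOpt.E m))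
    (hf_diff : ∀ i, Differentiable ℝ (f i))
    (hf_conv : ∀ i, ConvexOn ℝ Set.univ (f i))
    (hH_closed : ∀ i, IsClosed (H i)) (hH_conv : ∀ i, Convex ℝ (H i))
    (hX_nonempty : ∀ i, {s | gradient (f i) s = 0}.Nonempty)
    (hX_bounded : ∀ i, Bornology.IsBounded {s | gradient (f i) s = 0})
    (hH : (⋂ i, H i).Nonempty)
    {η dw M : ℝ} (hη : 0 < η) (hdw : 0 < dw) (hM : dw < M)
    (G : ℝ → DistOpt.CommGraph n η) (σ : ℕ → ℝ)
    (hG_balanced : ∀ t, 0 ≤ t → (G t).Balanced)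
    (hσ : DistOpt.IsSwitchingSequence G dw σ)
    (hG_conn : DistOpt.JointlyStronglyConnected G σ M)
    (x : Fin n → ℝ → DistOpt.E m) (q : Fin n → ℝ → ℝ)
    (hxq : DistOpt.IsTrajectory f H G σ x q) :
    (DistOpt.optimalSet f H).Nonempty ∧
    Bornology.IsBounded (DistOpt.optimalSet f H) ∧
    (∀ i, Filter.Tendsto (fun t => x i t - DistOpt.average (fun j => x j t))
      Filter.atTop (nhds 0)) ∧
    (∀ i, Filter.Tendsto (fun t => Metric.infDist (x i t) (DistOpt.optimalSet f H))
      Filter.atTop (nhds 0)) ∧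
    (∀ z ∈ DistOpt.optimalSet f H,
      Filter.Tendsto (fun t => ∑ i, f i (x i t)) Filter.atTop (nhds (∑ i, f i z))) := by
  have h : DistOpt.ClosedLoop f H dw M G σ x q :=
    ⟨hn, hf_diff, hf_conv, hH_closed, hH_conv, hX_nonempty, hX_bounded, hH, hη, hdw,
      hdw.trans hM, hG_balanced, hσ, hG_conn, hxq⟩
  exact ⟨h.optimalSet_nonempty, h.optimalSet_isBounded, h.tendsto_sub_average,
    h.tendsto_infDist_optimalSet, fun z hz => h.tendsto_objective hz⟩
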